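/- Let $f=x^4+y^4x+y^5$ on $\mathbb C^2$ and let $C=\{f=0\}\subset\mathbb C^2$ be the complex analytic curve with structure sheaf $\mathcal O_C=(\mathcal O_{\mathbb C^2}/(f))|_C$. Let $\Omega^1_C=\big(\Omega^1_{\mathbb C^2}/(f\,\Omega^1_{\mathbb C^2}+\mathcal O_{\mathbb C^2}\,df)\big)|_C$ be its sheaf of Kähler differentials, $\Omega^2_C=\bigwedge^2\Omega^1_C$, and $d$ the exterior derivative. Consider the $1$-form $$\alpha=\Big(x^4y+\frac{y^5x}{5}+\frac{y^6}{6}\Big)\,dx\in\Omega^1_C(C)$$ and the connection $\nabla=d+\alpha\colon\mathcal O_C\to\Omega^1_C$, $\nabla s=ds+s\,\alpha$. Then: 1. $\nabla$ is flat, i.e. its curvature $\mathcal O_C\to\Omega^2_C$ vanishes. 2. The sheaf $\ker\nabla$ of parallel sections is not a local system around $0\in C$: for no open neighbourhood $Y$ of $0$ in $C$ is $\ker\nabla|_Y$ a locally constant sheaf of finite-dimensional $\mathbb C$-vector spaces. 3. $\nabla$ is not tame: there are an open set $U\subseteq C$, a section $s\in\mathcal O_C(U)$ and a nowhere dense analytic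 subset $X\subseteq U$ such that $\nabla s|_{U\setminus X}=0$ but $\nabla s\neq 0$ in $\Omega^1_C(U)$. -/

import Mathlib

open Filter Topology TopologicalSpace

noncomputable section

namespace ReiffenCurve

/-! ### Germs of holomorphic functions on `ℂ²` -/

instance germAlgebra (p : ℂ × ℂ) : Algebra ℂ (Germ (𝓝 p) ℂ) :=
  Algebra.ofModule
    (fun c a b => by
      induction a using Germ.inductionOn
      induction b using Germ.inductionOn
      exact congrArg _ (funext fun _ => mul_assoc _ _ _))
    (fun c a b => by
      induction a using Germ.inductionOn
      induction b using Germ.inductionOn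
      exact congrArg _ (funext fun _ => mul_left_comm _ _ _))

/-- The stalk at `p` of the sheaf of holomorphic functions on `ℂ²`. -/
def HolGerm (p : ℂ × ℂ) : Subalgebra ℂ (Germ (𝓝 p) ℂ) where
  carrier := {g | ∃ h : ℂ × ℂ → ℂ, AnalyticAt ℂ h p ∧ g = (h : Germ (𝓝 p) ℂ)}
  mul_mem' := by
    rintro _ _ ⟨h, hh, rfl⟩ ⟨k, hk, rfl⟩
    exact ⟨h * k, hh.mul hk, rfl⟩
  add_mem' := by
    rintro _ _ ⟨h, hh, rfl⟩ ⟨k, hk, rfl⟩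
    exact ⟨h + k, hh.add hk, rfl⟩
  algebraMap_mem' c := by
    refine ⟨fun _ => c, analyticAt_const, ?_⟩
    rw [Algebra.algebraMap_eq_smul_one]
    exact congrArg _ (funext fun _ => mul_one c)

/-- The germ at `p` of a function that is holomorphic at `p`. -/
def HolGerm.mk {p : ℂ × ℂ} (h : ℂ × ℂ → ℂ) (hh : AnalyticAt ℂ h p) : HolGerm p :=
  ⟨(h : Germ (𝓝 p) ℂ), h, hh, rfl⟩

theorem HolGerm.exists_rep {p : ℂ × ℂ} (g : HolGerm p) :
    ∃ (h : ℂ × ℂ → ℂ) (hh : AnalyticAt ℂ h p), g = HolGerm.mk h hh := by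
  obtain ⟨g, h, hh, rfl⟩ := g
  exact ⟨h, hh, rfl⟩

theorem analyticAt_fderiv_apply {p : ℂ × ℂ} {h : ℂ × ℂ → ℂ} (hh : AnalyticAt ℂ h p)
    (v : ℂ × ℂ) : AnalyticAt ℂ (fun q => fderiv ℂ h q v) p :=
  ((ContinuousLinearMap.apply ℂ ℂ v).analyticAt _).comp hh.fderiv

/-- The derivative of a germ in the (constant) direction `v`. -/
def germDeriv {p : ℂ × ℂ} (v : ℂ × ℂ) (g : Germ (𝓝 p) ℂ) : Germ (𝓝 p) ℂ :=
  Germ.liftOn g (fun h => ((fun q => fderiv ℂ h q v : ℂ × ℂ → ℂ) : Germ (𝓝 p) ℂ))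
    (fun _ _ hab => Germ.coe_eq.2 (hab.fderiv.mono fun q hq => by
      change fderiv ℂ _ q v = fderiv ℂ _ q v
      rw [hq]))

/-- The derivation `∂/∂v` of the stalk `𝒪_{ℂ²,p}`. -/
def HolGerm.deriv {p : ℂ × ℂ} (v : ℂ × ℂ) : Derivation ℂ (HolGerm p) (HolGerm p) :=
  Derivation.mk'
    { toFun := fun g => ⟨germDeriv v g.1, by
        obtain ⟨h, hh, rfl⟩ := HolGerm.exists_rep g
        exact ⟨_, analyticAt_fderiv_apply hh v, rfl⟩⟩
      map_add' := fun a b => by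
        obtain ⟨h, hh, rfl⟩ := HolGerm.exists_rep a
        obtain ⟨k, hk, rfl⟩ := HolGerm.exists_rep b
        refine Subtype.ext (Germ.coe_eq.2 ?_)
        filter_upwards [hh.eventually_analyticAt, hk.eventually_analyticAt] with q hq kq
        change fderiv ℂ (h + k) q v = fderiv ℂ h q v + fderiv ℂ k q v
        rw [fderiv_add hq.differentiableAt kq.differentiableAt]
        rfl
      map_smul' := fun c a => by
        obtain ⟨h, hh, rfl⟩ := HolGerm.exists_rep a
        refine Subtype.ext (Germ.coe_eq.2 ?_)
        filter_upwards [hh.eventually_analyticAt] with q hq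
        change fderiv ℂ (c • h) q v = c • fderiv ℂ h q v
        rw [fderiv_const_smul hq.differentiableAt]
        rfl }
    (fun a b => by
      obtain ⟨h, hh, rfl⟩ := HolGerm.exists_rep a
      obtain ⟨k, hk, rfl⟩ := HolGerm.exists_rep b
      refine Subtype.ext (Germ.coe_eq.2 ?_)
      filter_upwards [hh.eventually_analyticAt, hk.eventually_analyticAt] with q hq kq
      change fderiv ℂ (h * k) q v = h q * fderiv ℂ k q v + k q * fderiv ℂ h q v
      rw [fderiv_mul hq.differentiableAt kq.differentiableAt]
      rfl)

theorem HolGerm.deriv_mk {p : ℂ × ℂ} (v : ℂ × ℂ) (h : ℂ × ℂ → ℂ) (hh : AnalyticAt ℂ h p) :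
    HolGerm.deriv v (HolGerm.mk h hh) =
      HolGerm.mk (fun q => fderiv ℂ h q v) (analyticAt_fderiv_apply hh v) :=
  rfl

theorem HolGerm.deriv_comm {p : ℂ × ℂ} (v w : ℂ × ℂ) (g : HolGerm p) :
    HolGerm.deriv v (HolGerm.deriv w g) = HolGerm.deriv w (HolGerm.deriv v g) := by
  obtain ⟨h, hh, rfl⟩ := HolGerm.exists_rep g
  refine Subtype.ext (Germ.coe_eq.2 ?_)
  filter_upwards [hh.eventually_analyticAt] with q hq
  have hs : IsSymmSndFDerivAt ℂ h q :=
    ContDiffAt.isSymmSndFDerivAt (n := 2) hq.contDiffAt (by simp)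
  have hd : DifferentiableAt ℂ (fderiv ℂ h) q := hq.fderiv.differentiableAt
  change fderiv ℂ (fun r => fderiv ℂ h r w) q v = fderiv ℂ (fun r => fderiv ℂ h r v) q w
  rw [fderiv_clm_apply hd (differentiableAt_const _),
    fderiv_clm_apply hd (differentiableAt_const _)]
  simpa using hs v w

/-! ### The curve as a complex analytic space -/

/-- The polynomial `f = x⁴ + y⁴x + y⁵`. -/
def f (z : ℂ × ℂ) : ℂ := z.1 ^ 4 + z.2 ^ 4 * z.1 + z.2 ^ 5

theorem analyticAt_f (p : ℂ × ℂ) : AnalyticAt ℂ f p := by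
  exact ((analyticAt_fst.pow 4).add ((analyticAt_snd.pow 4).mul analyticAt_fst)).add
    (analyticAt_snd.pow 5)

/-- The underlying topological space of the curve `C`. -/
abbrev Curve : Type := {z : ℂ × ℂ // f z = 0}

/-- The singular point `0 ∈ C`. -/
def origin : Curve := ⟨(0, 0), by simp [f]⟩

/-- The stalk at `p` of the ideal sheaf `J` generated by `f`. -/
def J (p : ℂ × ℂ) : Ideal (HolGerm p) := Ideal.span {HolGerm.mk f (analyticAt_f p)}

/-- The stalk `𝒪_{C,p} = 𝒪_{ℂ²,p} / J_p` of the structure sheaf of `C`. -/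
def OStalk (p : ℂ × ℂ) : Type := HolGerm p ⧸ J p

instance (p : ℂ × ℂ) : CommRing (OStalk p) := inferInstanceAs (CommRing (HolGerm p ⧸ J p))

instance (p : ℂ × ℂ) : Algebra ℂ (OStalk p) := inferInstanceAs (Algebra ℂ (HolGerm p ⧸ J p))

/-- The quotient map `𝒪_{ℂ²,p} → 𝒪_{C,p}`. -/
def toO (p : ℂ × ℂ) : HolGerm p →ₐ[ℂ] OStalk p := Ideal.Quotient.mkₐ ℂ (J p)

theorem toO_surjective (p : ℂ × ℂ) : Function.Surjective (toO p) := Ideal.Quotient.mk_surjective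

theorem toO_eq_zero_iff {p : ℂ × ℂ} (g : HolGerm p) : toO p g = 0 ↔ g ∈ J p :=
  Ideal.Quotient.eq_zero_iff_mem

/-- The restriction to `C` of the germ at `p` of a holomorphic function on `ℂ²`. -/
def OStalk.mk {p : ℂ × ℂ} (h : ℂ × ℂ → ℂ) (hh : AnalyticAt ℂ h p) : OStalk p :=
  toO p (HolGerm.mk h hh)

/-- The total differential `g ↦ (∂g/∂x) dx + (∂g/∂y) dy` of an ambient germ, with the coefficients
restricted to `C`; the pair `(a, b)` stands for `a dx + b dy`. -/
def ambientD (p : ℂ × ℂ) : HolGerm p →ₗ[ℂ] OStalk p × OStalk p where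
  toFun g := (toO p (HolGerm.deriv (1, 0) g),
    toO p (HolGerm.deriv (0, 1) g))
  map_add' a b := by simp
  map_smul' c a := by
    simp

/-- The `𝒪_{C,p}`-submodule generated by `dJ`. -/
def dJ (p : ℂ × ℂ) : Submodule (OStalk p) (OStalk p × OStalk p) :=
  Submodule.span (OStalk p) (ambientD p '' (J p : Set (HolGerm p)))

/-- The stalk at `p` of the Kähler differentials of the complex space `C`:
`Ω¹_{C,p} = Ω¹_{ℂ²,p} / (J Ω¹_{ℂ²} + 𝒪 dJ)_p`. -/
def Omega1Stalk (p : ℂ × ℂ) : Type := (OStalk p × OStalk p) ⧸ dJ p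

instance (p : ℂ × ℂ) : AddCommGroup (Omega1Stalk p) :=
  inferInstanceAs (AddCommGroup ((OStalk p × OStalk p) ⧸ dJ p))

instance (p : ℂ × ℂ) : Module (OStalk p) (Omega1Stalk p) :=
  inferInstanceAs (Module (OStalk p) ((OStalk p × OStalk p) ⧸ dJ p))

instance (p : ℂ × ℂ) : Module ℂ (Omega1Stalk p) :=
  inferInstanceAs (Module ℂ ((OStalk p × OStalk p) ⧸ dJ p))

instance (p : ℂ × ℂ) : IsScalarTower ℂ (OStalk p) (Omega1Stalk p) :=
  inferInstanceAs (IsScalarTower ℂ (OStalk p) ((OStalk p × OStalk p) ⧸ dJ p))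

/-- The quotient map `𝒪_{C,p} dx ⊕ 𝒪_{C,p} dy → Ω¹_{C,p}`. -/
def toOmega1 (p : ℂ × ℂ) : OStalk p × OStalk p →ₗ[OStalk p] Omega1Stalk p := (dJ p).mkQ

theorem toOmega1_eq_zero_iff {p : ℂ × ℂ} (ω : OStalk p × OStalk p) :
    toOmega1 p ω = 0 ↔ ω ∈ dJ p :=
  Submodule.Quotient.mk_eq_zero _

/-- The class of `a dx + b dy` in `Ω¹_{C,p}`. -/
def Omega1Stalk.mk {p : ℂ × ℂ} (a b : OStalk p) : Omega1Stalk p :=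
  toOmega1 p (a, b)

/-- `Ω²_{C,p}`, the second exterior power of `Ω¹_{C,p}` over `𝒪_{C,p}`. -/
def Omega2Stalk (p : ℂ × ℂ) : Type := ⋀[OStalk p]^2 (Omega1Stalk p)

instance (p : ℂ × ℂ) : AddCommGroup (Omega2Stalk p) :=
  inferInstanceAs (AddCommGroup (⋀[OStalk p]^2 (Omega1Stalk p)))

instance (p : ℂ × ℂ) : Module (OStalk p) (Omega2Stalk p) :=
  inferInstanceAs (Module (OStalk p) (⋀[OStalk p]^2 (Omega1Stalk p)))

/-- The universal alternating map `Ω¹_{C,p} × Ω¹_{C,p} → Ω²_{C,p}`. -/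
def wedgeMap (p : ℂ × ℂ) : (Omega1Stalk p) [⋀^Fin 2]→ₗ[OStalk p] (Omega2Stalk p) :=
  exteriorPower.ιMulti (OStalk p) 2

/-- The wedge product of two one-forms. -/
def wedge {p : ℂ × ℂ} (ω η : Omega1Stalk p) : Omega2Stalk p :=
  wedgeMap p ![ω, η]

theorem wedge_add_left {p : ℂ × ℂ} (ω ω' η : Omega1Stalk p) :
    wedge (ω + ω') η = wedge ω η + wedge ω' η :=
  AlternatingMap.map_vecCons_add _ _ _ _

theorem wedge_smul_left {p : ℂ × ℂ} (c : OStalk p) (ω η : Omega1Stalk p) :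
    wedge (c • ω) η = c • wedge ω η :=
  AlternatingMap.map_vecCons_smul _ _ _ _

theorem wedge_self {p : ℂ × ℂ} (ω : Omega1Stalk p) : wedge ω ω = 0 :=
  AlternatingMap.map_eq_zero_of_eq _ _ (i := 0) (j := 1) rfl (by decide)

theorem wedge_swap {p : ℂ × ℂ} (ω η : Omega1Stalk p) : wedge ω η = -wedge η ω := by
  have h := AlternatingMap.map_swap (wedgeMap p)
    ![η, ω] (i := 0) (j := 1) (by decide)
  have e : (![η, ω] ∘ Equiv.swap (0 : Fin 2) 1) = ![ω, η] := by
    funext i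
    fin_cases i <;> simp
  rw [e] at h
  exact h

theorem wedge_add_right {p : ℂ × ℂ} (ω η η' : Omega1Stalk p) :
    wedge ω (η + η') = wedge ω η + wedge ω η' := by
  rw [wedge_swap, wedge_add_left, wedge_swap ω η, wedge_swap ω η', neg_add]

theorem wedge_smul_right {p : ℂ × ℂ} (c : OStalk p) (ω η : Omega1Stalk p) :
    wedge ω (c • η) = c • wedge ω η := by
  rw [wedge_swap, wedge_smul_left, wedge_swap ω η, smul_neg]

theorem Omega1Stalk.mk_eq {p : ℂ × ℂ} (a b : OStalk p) :
    Omega1Stalk.mk a b = a • Omega1Stalk.mk 1 0 + b • Omega1Stalk.mk 0 1 := by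
  simp only [Omega1Stalk.mk, ← map_smul, ← map_add]
  simp

/-- The exterior derivative `d : 𝒪_{C,p} → Ω¹_{C,p}`, induced by the ambient total differential. -/
def d0 (p : ℂ × ℂ) : OStalk p →ₗ[ℂ] Omega1Stalk p :=
  (((J p).restrictScalars ℂ).liftQ (((toOmega1 p).restrictScalars ℂ) ∘ₗ ambientD p)
    (fun _ hg => (toOmega1_eq_zero_iff _).2
      (Submodule.subset_span (Set.mem_image_of_mem _ hg)))) ∘ₗ
    (Submodule.Quotient.restrictScalarsEquiv ℂ (J p)).symm.toLinearMap

theorem d0_mk {p : ℂ × ℂ} (g : HolGerm p) :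
    d0 p (toO p g) =
      Omega1Stalk.mk (toO p (HolGerm.deriv (1, 0) g))
        (toO p (HolGerm.deriv (0, 1) g)) :=
  rfl

theorem d0_mul {p : ℂ × ℂ} (a b : OStalk p) : d0 p (a * b) = a • d0 p b + b • d0 p a := by
  obtain ⟨a, rfl⟩ := toO_surjective p a
  obtain ⟨b, rfl⟩ := toO_surjective p b
  rw [← map_mul, d0_mk, d0_mk, d0_mk]
  simp only [Omega1Stalk.mk, ← map_smul, ← map_add]
  simp

/-- The map `a dx + b dy ↦ da ∧ dx + db ∧ dy`, before passing to the quotient by `dJ`. -/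
def preD1 (p : ℂ × ℂ) : OStalk p × OStalk p →+ Omega2Stalk p where
  toFun ω := wedge (d0 p ω.1) (Omega1Stalk.mk 1 0) + wedge (d0 p ω.2) (Omega1Stalk.mk 0 1)
  map_zero' := by
    have h : wedge (0 : Omega1Stalk p) = fun _ => 0 := by
      funext η
      simpa using wedge_smul_left 0 (0 : Omega1Stalk p) η
    simp [h]
  map_add' a b := by
    simp only [Prod.fst_add, Prod.snd_add, map_add, wedge_add_left]
    abel

theorem preD1_smul {p : ℂ × ℂ} (c : OStalk p) (ω : OStalk p × OStalk p) :
    preD1 p (c • ω) = wedge (d0 p c) (Omega1Stalk.mk ω.1 ω.2) + c • preD1 p ω := by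
  change wedge (d0 p (c * ω.1)) _ + wedge (d0 p (c * ω.2)) _ = _ + c • (_ + _)
  rw [Omega1Stalk.mk_eq ω.1 ω.2]
  simp only [d0_mul, wedge_add_left, wedge_add_right, wedge_smul_left, wedge_smul_right, smul_add]
  abel

theorem preD1_ambientD {p : ℂ × ℂ} (g : HolGerm p) : preD1 p (ambientD p g) = 0 := by
  change wedge (d0 p (toO p (HolGerm.deriv (1, 0) g))) _ +
    wedge (d0 p (toO p (HolGerm.deriv (0, 1) g))) _ = 0
  rw [d0_mk, d0_mk, Omega1Stalk.mk_eq,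
    Omega1Stalk.mk_eq (toO p (HolGerm.deriv (1, 0) (HolGerm.deriv (0, 1) g))),
    HolGerm.deriv_comm (0, 1) (1, 0) g]
  simp only [wedge_add_left, wedge_smul_left, wedge_self, smul_zero, zero_add, add_zero]
  rw [wedge_swap, smul_neg, neg_add_cancel]

theorem preD1_eq_zero {p : ℂ × ℂ} (ω : OStalk p × OStalk p) (hω : ω ∈ dJ p) :
    preD1 p ω = 0 := by
  induction hω using Submodule.span_induction with
  | mem x hx =>
    obtain ⟨g, -, rfl⟩ := hx
    exact preD1_ambientD g
  | zero => exact map_zero _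
  | add x y _ _ hx hy => rw [map_add, hx, hy, add_zero]
  | smul c x hx ih =>
    have h0 : Omega1Stalk.mk x.1 x.2 = 0 := (toOmega1_eq_zero_iff _).2 hx
    have hw : wedge (d0 p c) (0 : Omega1Stalk p) = 0 := by
      simpa using wedge_smul_right 0 (d0 p c) (0 : Omega1Stalk p)
    rw [preD1_smul, ih, h0, hw, smul_zero, add_zero]

/-- The exterior derivative `d : Ω¹_{C,p} → Ω²_{C,p}`, `d(a dx + b dy) = da ∧ dx + db ∧ dy`. -/
def d1 (p : ℂ × ℂ) : Omega1Stalk p →+ Omega2Stalk p :=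
  QuotientAddGroup.lift (dJ p).toAddSubgroup (preD1 p) (fun ω hω => preD1_eq_zero ω hω)

theorem d1_mk {p : ℂ × ℂ} (a b : OStalk p) :
    d1 p (Omega1Stalk.mk a b) =
      wedge (d0 p a) (Omega1Stalk.mk 1 0) + wedge (d0 p b) (Omega1Stalk.mk 0 1) :=
  rfl

/-! ### Sections -/

/-- The sections over `U ⊆ C` of the structure sheaf `𝒪_C = 𝒪_{ℂ²} / (f)`: families of elements of
the stalks that are locally induced by one holomorphic function on an open subset of `ℂ²`. -/
def OSec (U : Opens Curve) : Subalgebra ℂ (∀ p : U, OStalk p.1.1) where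
  carrier := {s | ∀ p : U, ∃ W : Set (ℂ × ℂ), IsOpen W ∧ p.1.1 ∈ W ∧
    ∃ (h : ℂ × ℂ → ℂ) (hh : AnalyticOnNhd ℂ h W),
      ∀ (q : U) (hq : q.1.1 ∈ W), s q = OStalk.mk h (hh q.1.1 hq)}
  mul_mem' := by
    intro s t hs ht p
    obtain ⟨W, hW, hpW, h, hh, hs⟩ := hs p
    obtain ⟨V, hV, hpV, k, hk, ht⟩ := ht p
    refine ⟨W ∩ V, hW.inter hV, ⟨hpW, hpV⟩, h * k,
      fun z hz => (hh z hz.1).mul (hk z hz.2), fun q hq => ?_⟩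
    rw [Pi.mul_apply, hs q hq.1, ht q hq.2]
    rfl
  add_mem' := by
    intro s t hs ht p
    obtain ⟨W, hW, hpW, h, hh, hs⟩ := hs p
    obtain ⟨V, hV, hpV, k, hk, ht⟩ := ht p
    refine ⟨W ∩ V, hW.inter hV, ⟨hpW, hpV⟩, h + k,
      fun z hz => (hh z hz.1).add (hk z hz.2), fun q hq => ?_⟩
    rw [Pi.add_apply, hs q hq.1, ht q hq.2]
    rfl
  algebraMap_mem' c := by
    intro p
    refine ⟨Set.univ, isOpen_univ, trivial, fun _ => c, fun _ _ => analyticAt_const,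
      fun q _ => ?_⟩
    have h : algebraMap ℂ (HolGerm q.1.1) c = HolGerm.mk (fun _ => c) analyticAt_const := by
      refine Subtype.ext ?_
      change algebraMap ℂ (Germ (𝓝 q.1.1) ℂ) c = _
      rw [Algebra.algebraMap_eq_smul_one]
      exact congrArg _ (funext fun _ => mul_one c)
    exact congrArg (toO q.1.1) h

/-- The sections over `U ⊆ C` of the sheaf `Ω¹_C`: families of elements of the stalks that are
locally induced by one holomorphic one-form `a dx + b dy` on an open subset of `ℂ²`. -/
def Omega1Sec (U : Opens Curve) : Submodule ℂ (∀ p : U, Omega1Stalk p.1.1) where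
  carrier := {ω | ∀ p : U, ∃ W : Set (ℂ × ℂ), IsOpen W ∧ p.1.1 ∈ W ∧
    ∃ (a b : ℂ × ℂ → ℂ) (ha : AnalyticOnNhd ℂ a W) (hb : AnalyticOnNhd ℂ b W),
      ∀ (q : U) (hq : q.1.1 ∈ W),
        ω q = Omega1Stalk.mk (OStalk.mk a (ha q.1.1 hq)) (OStalk.mk b (hb q.1.1 hq))}
  zero_mem' := by
    intro p
    exact ⟨Set.univ, isOpen_univ, trivial, 0, 0, fun _ _ => analyticAt_const,
      fun _ _ => analyticAt_const, fun q _ => rfl⟩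
  add_mem' := by
    intro s t hs ht p
    obtain ⟨W, hW, hpW, a, b, ha, hb, hs⟩ := hs p
    obtain ⟨V, hV, hpV, a', b', ha', hb', ht⟩ := ht p
    refine ⟨W ∩ V, hW.inter hV, ⟨hpW, hpV⟩, a + a', b + b',
      fun z hz => (ha z hz.1).add (ha' z hz.2), fun z hz => (hb z hz.1).add (hb' z hz.2),
      fun q hq => ?_⟩
    rw [Pi.add_apply, hs q hq.1, ht q hq.2]
    rfl
  smul_mem' c s hs := by
    intro p
    obtain ⟨W, hW, hpW, a, b, ha, hb, hs⟩ := hs p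
    refine ⟨W, hW, hpW, c • a, c • b, fun z hz => (ha z hz).const_smul,
      fun z hz => (hb z hz).const_smul, fun q hq => ?_⟩
    rw [Pi.smul_apply, hs q hq]
    rfl

/-- Restriction of sections of `𝒪_C`. -/
def OSec.res {U V : Opens Curve} (h : V ≤ U) : OSec U →ₐ[ℂ] OSec V where
  toFun s := ⟨fun p => s.1 ⟨p.1, h p.2⟩, fun p => by
    obtain ⟨W, hW, hpW, k, hk, hs⟩ := s.2 ⟨p.1, h p.2⟩
    exact ⟨W, hW, hpW, k, hk, fun q hq => hs ⟨q.1, h q.2⟩ hq⟩⟩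
  map_one' := rfl
  map_mul' _ _ := rfl
  map_zero' := rfl
  map_add' _ _ := rfl
  commutes' _ := rfl

/-- Restriction of sections of `Ω¹_C`. -/
def Omega1Sec.res {U V : Opens Curve} (h : V ≤ U) : Omega1Sec U →ₗ[ℂ] Omega1Sec V where
  toFun s := ⟨fun p => s.1 ⟨p.1, h p.2⟩, fun p => by
    obtain ⟨W, hW, hpW, a, b, ha, hb, hs⟩ := s.2 ⟨p.1, h p.2⟩
    exact ⟨W, hW, hpW, a, b, ha, hb, fun q hq => hs ⟨q.1, h q.2⟩ hq⟩⟩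
  map_add' _ _ := rfl
  map_smul' _ _ := rfl

/-- The exterior derivative `d : 𝒪_C(U) → Ω¹_C(U)`. -/
def dSec (U : Opens Curve) : OSec U →ₗ[ℂ] Omega1Sec U where
  toFun s := ⟨fun p => d0 p.1.1 (s.1 p), fun p => by
    obtain ⟨W, hW, hpW, h, hh, hs⟩ := s.2 p
    exact ⟨W, hW, hpW, _, _, fun z hz => analyticAt_fderiv_apply (hh z hz) (1, 0),
      fun z hz => analyticAt_fderiv_apply (hh z hz) (0, 1),
      fun q hq => (congrArg (d0 q.1.1) (hs q hq)).trans rfl⟩⟩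
  map_add' _ _ := Subtype.ext (funext fun _ => map_add _ _ _)
  map_smul' c s := Subtype.ext (funext fun p => (d0 p.1.1).map_smul c (s.1 p))

/-- The product of a function and a one-form on `U`. -/
def smulForm {U : Opens Curve} (s : OSec U) (ω : Omega1Sec U) : Omega1Sec U :=
  ⟨fun p => s.1 p • ω.1 p, fun p => by
    obtain ⟨W, hW, hpW, h, hh, hs⟩ := s.2 p
    obtain ⟨V, hV, hpV, a, b, ha, hb, ht⟩ := ω.2 p
    refine ⟨W ∩ V, hW.inter hV, ⟨hpW, hpV⟩, h * a, h * b,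
      fun z hz => (hh z hz.1).mul (ha z hz.2), fun z hz => (hh z hz.1).mul (hb z hz.2),
      fun q hq => ?_⟩
    change s.1 q • ω.1 q = _
    rw [hs q hq.1, ht q hq.2]
    rfl⟩

/-! ### Connections on `𝒪_C` -/

/-- A connection on `𝒪_C`: a `ℂ`-linear morphism of sheaves `∇ : 𝒪_C → Ω¹_C ⊗ 𝒪_C = Ω¹_C` that
satisfies the Leibniz rule. -/
structure Connection where
  toFun : ∀ U : Opens Curve, OSec U →ₗ[ℂ] Omega1Sec U
  map_res : ∀ {U V : Opens Curve} (h : V ≤ U) (s : OSec U),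
    toFun V (OSec.res h s) = Omega1Sec.res h (toFun U s)
  leibniz : ∀ {U : Opens Curve} (g s : OSec U),
    toFun U (g * s) = smulForm s (dSec U g) + smulForm g (toFun U s)

/-- The connection `d + α` attached to a global one-form `α`: `s ↦ ds + s α`. -/
def dPlus (α : Omega1Sec ⊤) : Connection where
  toFun U :=
    { toFun := fun s => dSec U s + smulForm s (Omega1Sec.res le_top α)
      map_add' := fun s t => by
        refine Subtype.ext (funext fun p => ?_)
        change d0 p.1.1 (s.1 p + t.1 p) + (s.1 p + t.1 p) • α.1 ⟨p.1, trivial⟩ =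
          (d0 p.1.1 (s.1 p) + s.1 p • α.1 ⟨p.1, trivial⟩) +
            (d0 p.1.1 (t.1 p) + t.1 p • α.1 ⟨p.1, trivial⟩)
        rw [map_add, add_smul]
        abel
      map_smul' := fun c s => by
        refine Subtype.ext (funext fun p => ?_)
        change d0 p.1.1 (c • s.1 p) + (c • s.1 p) • α.1 ⟨p.1, trivial⟩ =
          c • (d0 p.1.1 (s.1 p) + s.1 p • α.1 ⟨p.1, trivial⟩)
        rw [map_smul, smul_add, smul_assoc] }
  map_res _ _ := rfl
  leibniz {U} g s := by
    refine Subtype.ext (funext fun p => ?_)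
    change d0 p.1.1 (g.1 p * s.1 p) + (g.1 p * s.1 p) • α.1 ⟨p.1, trivial⟩ =
      s.1 p • d0 p.1.1 (g.1 p) + g.1 p • (d0 p.1.1 (s.1 p) + s.1 p • α.1 ⟨p.1, trivial⟩)
    rw [d0_mul, smul_add, mul_smul]
    abel

namespace Connection

variable (D : Connection)

/-- The curvature `F(s) = ∇⁽¹⁾(∇ s)` as a family of elements of the stalks of `Ω²_C`, where
`∇⁽¹⁾(β ⊗ 1) = dβ ⊗ 1 - β ∧ ∇ 1`. -/
def curvature {U : Opens Curve} (s : OSec U) (p : U) : Omega2Stalk p.1.1 :=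
  d1 p.1.1 ((D.toFun U s).1 p) - wedge ((D.toFun U s).1 p) ((D.toFun U 1).1 p)

/-- A connection is flat if its curvature vanishes. -/
def IsFlat : Prop :=
  ∀ (U : Opens Curve) (s : OSec U) (p : U), D.curvature s p = 0

/-- The sections over `U` of the sheaf `ker ∇` of parallel sections. -/
def ker (U : Opens Curve) : Submodule ℂ (OSec U) := LinearMap.ker (D.toFun U)

/-- Restriction of parallel sections. -/
def kerRes {U V : Opens Curve} (h : V ≤ U) (s : D.ker U) : D.ker V :=
  ⟨OSec.res h s.1, by
    have hs : D.toFun U s.1 = 0 := s.2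
    change D.toFun V _ = 0
    rw [D.map_res, hs, map_zero]⟩

/-- The sheaf `ker ∇` is a local system on the open set `Y`: every point of `Y` has an open
neighbourhood `U ⊆ Y` on which `ker ∇` is isomorphic, as a sheaf of `ℂ`-vector spaces, to the
constant sheaf with values in some `ℂⁿ`, that is, to the sheaf of locally constant functions with
values in `ℂⁿ`. -/
def KerIsLocalSystemOn (Y : Opens Curve) : Prop :=
  ∀ p ∈ Y, ∃ U : Opens Curve, p ∈ U ∧ U ≤ Y ∧ ∃ (n : ℕ)
    (φ : ∀ W : Opens Curve, W ≤ U → (D.ker W ≃ₗ[ℂ] LocallyConstant W (Fin n → ℂ))),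
    ∀ (W V : Opens Curve) (hVW : V ≤ W) (hW : W ≤ U) (s : D.ker W) (q : V),
      φ V (hVW.trans hW) (D.kerRes hVW s) q = φ W hW s ⟨q.1, hVW q.2⟩

end Connection

/-- `X` is an analytic subset of the open subspace `U` of `C`: around every point of `U` it is the
common zero set of finitely many holomorphic functions. -/
def IsAnalyticSubset {U : Opens Curve} (X : Set U) : Prop :=
  ∀ p : U, ∃ W : Set (ℂ × ℂ), IsOpen W ∧ p.1.1 ∈ W ∧ ∃ (n : ℕ) (g : Fin n → ℂ × ℂ → ℂ),
    (∀ i, AnalyticOnNhd ℂ (g i) W) ∧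
      ∀ q : U, q.1.1 ∈ W → (q ∈ X ↔ ∀ i, g i q.1.1 = 0)

/-- A connection is tame if, for every section `s` over an open set `U` and every nowhere dense
analytic subset `X` of `U`, the vanishing of `∇ s` on `U \ X` implies `∇ s = 0`. -/
def Connection.IsTame (D : Connection) : Prop :=
  ∀ (U : Opens Curve) (s : OSec U) (X : Set U), IsAnalyticSubset X → IsNowhereDense X →
    (∀ p : U, p ∉ X → (D.toFun U s).1 p = 0) → D.toFun U s = 0

/-! ### The one-form -/

/-- The coefficient `x⁴y + y⁵x/5 + y⁶/6`. -/
def coeff (z : ℂ × ℂ) : ℂ := z.1 ^ 4 * z.2 + z.2 ^ 5 * z.1 / 5 + z.2 ^ 6 / 6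

theorem analyticAt_coeff (p : ℂ × ℂ) : AnalyticAt ℂ coeff p := by
  exact (((analyticAt_fst.pow 4).mul analyticAt_snd).add
    (((analyticAt_snd.pow 5).mul analyticAt_fst).div_const)).add ((analyticAt_snd.pow 6).div_const)

/-- The one-form `α = (x⁴y + y⁵x/5 + y⁶/6) dx` on `C`. -/
def alpha : Omega1Sec ⊤ :=
  ⟨fun p => Omega1Stalk.mk (OStalk.mk coeff (analyticAt_coeff p.1.1)) 0, fun _ =>
    ⟨Set.univ, isOpen_univ, trivial, coeff, 0, fun z _ => analyticAt_coeff z,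
      fun _ _ => analyticAt_const, fun _ _ => rfl⟩⟩

end ReiffenCurve

end

noncomputable section

namespace ReiffenCurve

/-! ### Division by a coordinate -/

/-! The coefficient a of α satisfies ∂a/∂y = f, so dα = -f dx∧dy vanishes on C; since α∧α = 0,
flatness follows.

Putting t = x/y in f = 0 gives t⁴ + (1+t)y = 0, hence the parametrization γ = `gamma`, along which x
and y have orders 5 and 4. The semigroup generated by 4 and 5 has conductor 12, so every t¹²H(t) is
the pullback of a holomorphic function on ℂ² (`exists_comp_gamma_eq`). As γ*α vanishes to order 28,
it has a primitive of the form g∘γ (`exists_potential`). At a smooth point an element of the local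
ring is determined by its pullback under γ (`OStalk.mk_eq_mk`), so exp(-g) is parallel away from 0.

At 0 there is an obstruction: a parallel germ S satisfies S(0) = 0 (`eval_eq_zero_of_parallel`).
Lifting the equation dS + Sα = 0 to ℂ² and cross-differentiating gives b f_x + e f_y = c f + a S_y
with S(0) = c(0) + b_x(0) + e_y(0). The monomials x⁴ and y⁵ force weights 1/4 and 1/5, for which xy⁴
has weight 21/20 ≠ 1; so f is not quasi-homogeneous, and comparing Taylor coefficients kills all
three summands (`taylor_eq_zero_of_logarithmic`).

Thus exp(-g), whose value at 0 is nonzero, is not parallel at 0, and tameness fails. For any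
parallel S near 0 the function (S exp g)∘γ is constant and zero at t = 0, so S vanishes off the
origin near 0 (`exists_kerRes_eq_zero`). But exp(-g) is a nonzero parallel section off the origin,
so no rank is possible for a local system. -/

/-- The `n`-th Taylor term of `(K z - K (z.1, 0)) / z.2`, where `P` is the Taylor term of `K` of
degree `n + 1`. -/
def divTerm {n : ℕ} (P : ContinuousMultilinearMap ℂ (fun _ : Fin (n + 1) => ℂ × ℂ) ℂ) :
    ContinuousMultilinearMap ℂ (fun _ : Fin n => ℂ × ℂ) ℂ :=
  ∑ j : Fin (n + 1), (P.curryMid j (0, 1)).compContinuousLinearMap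
    (fun i => if i.castSucc < j then ContinuousLinearMap.id ℂ (ℂ × ℂ)
      else (ContinuousLinearMap.inl ℂ ℂ ℂ).comp (ContinuousLinearMap.fst ℂ ℂ ℂ))

theorem norm_divTerm_le {n : ℕ}
    (P : ContinuousMultilinearMap ℂ (fun _ : Fin (n + 1) => ℂ × ℂ) ℂ) :
    ‖divTerm P‖ ≤ (n + 1) * ‖P‖ := by
  have key : ∀ j : Fin (n + 1), ‖(P.curryMid j (0, 1)).compContinuousLinearMap
      (fun i => if i.castSucc < j then ContinuousLinearMap.id ℂ (ℂ × ℂ)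
      else (ContinuousLinearMap.inl ℂ ℂ ℂ).comp (ContinuousLinearMap.fst ℂ ℂ ℂ))‖ ≤ ‖P‖ := by
    intro j
    refine ContinuousMultilinearMap.opNorm_le_bound (norm_nonneg _) fun m => ?_
    rw [ContinuousMultilinearMap.compContinuousLinearMap_apply,
      ContinuousMultilinearMap.curryMid_apply]
    refine (P.le_opNorm _).trans (mul_le_mul_of_nonneg_left ?_ (norm_nonneg _))
    rw [Fin.prod_univ_succAbove _ j]
    simp only [Fin.insertNth_apply_same, Fin.insertNth_apply_succAbove]
    -- With the sup norm on ℂ × ℂ the inserted vector has norm 1 and the projection to the first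
    -- axis does not increase norms.
    rw [show ‖((0 : ℂ), (1 : ℂ))‖ = 1 by simp [Prod.norm_def], one_mul]
    refine Finset.prod_le_prod (fun _ _ => norm_nonneg _) fun i _ => ?_
    split_ifs
    · simp
    · simp [Prod.norm_def]
  refine (norm_sum_le _ _).trans ((Finset.sum_le_sum fun j _ => key j).trans ?_)
  simp

/-- Telescoping: replace the arguments (x, 0) by z one slot at a time. Each replacement changes the
value by P with y·(0, 1) in that slot, and multilinearity pulls out the factor y. -/
theorem divTerm_apply {n : ℕ}
    (P : ContinuousMultilinearMap ℂ (fun _ : Fin (n + 1) => ℂ × ℂ) ℂ) (z : ℂ × ℂ) :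
    z.2 * divTerm P (fun _ => z) = P (fun _ => z) - P (fun _ => (z.1, 0)) := by
  set v : ℕ → Fin (n + 1) → ℂ × ℂ := fun k i => if i.1 < k then z else (z.1, 0) with hv
  have h0 : v 0 = fun _ => (z.1, 0) := by funext i; simp [hv]
  have h1 : v (n + 1) = fun _ => z := by funext i; simp [hv, i.2]
  rw [← h0, ← h1, ← Finset.sum_range_sub (fun k => P (v k)), Finset.sum_range, divTerm,
    _root_.sum_apply, Finset.mul_sum]
  refine Finset.sum_congr rfl fun j _ => ?_
  have e1 : v (j + 1) = Function.update (v j) j z := by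
    funext i
    rcases eq_or_ne i j with rfl | h
    · simp [hv]
    · have : i.1 ≠ j.1 := fun hh => h (Fin.ext hh)
      simp only [hv, Function.update_of_ne h]
      congr 1
      simp only [eq_iff_iff]; omega
  have e2 : v j = Function.update (v j) j (z.1, 0) := by
    funext i
    rcases eq_or_ne i j with rfl | h
    · simp [hv]
    · simp [Function.update_of_ne h]
  have e3 : P (v (j + 1)) - P (v j) = P (Function.update (v j) j (z.2 • ((0, 1) : ℂ × ℂ))) := by
    rw [e1]
    nth_rewrite 2 [e2]
    rw [← P.map_update_sub]
    congr 2
    ext <;> simp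
  rw [e3, P.map_update_smul, smul_eq_mul, ContinuousMultilinearMap.compContinuousLinearMap_apply,
    ContinuousMultilinearMap.curryMid_apply]
  congr 2
  refine (Fin.insertNth_eq_iff.2 ⟨?_, ?_⟩)
  · simp
  · funext i
    have h : j.succAbove i ≠ j := Fin.succAbove_ne j i
    simp only [Fin.removeNth, Function.update_of_ne h, hv]
    by_cases hi : i.castSucc < j
    · rw [Fin.succAbove_of_castSucc_lt _ _ hi]
      have : i.1 < j.1 := hi
      simp [hi, this]
    · rw [Fin.succAbove_of_le_castSucc _ _ (not_lt.1 hi)]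
      have : ¬ i.1 < j.1 := hi
      have h2 : ¬ i.1 + 1 < j.1 := by omega
      simp [hi, h2]

/-- The Taylor series is divided by y degree by degree. The factor n + 1 in `norm_divTerm_le` grows
subexponentially, so the radius of convergence stays positive. -/
theorem exists_eq_snd_mul_zero {K : ℂ × ℂ → ℂ} (hK : AnalyticAt ℂ K 0) :
    ∃ L : ℂ × ℂ → ℂ, AnalyticAt ℂ L 0 ∧ ∀ᶠ z in 𝓝 (0 : ℂ × ℂ), K z - K (z.1, 0) = z.2 * L z := by
  obtain ⟨p, r, hp⟩ := hK
  set q : FormalMultilinearSeries ℂ (ℂ × ℂ) ℂ := fun n => divTerm (p (n + 1)) with hq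
  have hrad : 0 < q.radius := by
    obtain ⟨ρ, hρ0, hρ⟩ := ENNReal.lt_iff_exists_nnreal_btwn.1 hp.radius_pos
    have hρ0' : 0 < ρ := by exact_mod_cast hρ0
    obtain ⟨C, hC, hb⟩ := p.norm_mul_pow_le_of_lt_radius hρ
    -- Halving the radius absorbs the factor n + 1 ≤ 2 ^ n.
    refine lt_of_lt_of_le (ENNReal.coe_pos.2 (half_pos hρ0'))
      (q.le_radius_of_bound (C / ρ) (r := ρ / 2) fun n => ?_)
    have hn : ((n : ℝ) + 1) ≤ 2 ^ n := by
      exact_mod_cast Nat.lt_two_pow_self (n := n)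
    have hρr : (0 : ℝ) < ρ := hρ0'
    have h1 := hb (n + 1)
    push_cast
    rw [div_pow, le_div_iff₀ hρr]
    calc ‖q n‖ * ((ρ : ℝ) ^ n / 2 ^ n) * ρ
        ≤ (2 ^ n * ‖p (n + 1)‖) * ((ρ : ℝ) ^ n / 2 ^ n) * ρ := by
          have := (norm_divTerm_le (p (n + 1))).trans
            (mul_le_mul_of_nonneg_right hn (norm_nonneg _))
          gcongr
      _ = ‖p (n + 1)‖ * (ρ : ℝ) ^ (n + 1) := by
          rw [pow_succ]
          field_simp
      _ ≤ C := h1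
  have hqs := q.hasFPowerSeriesOnBall hrad
  refine ⟨q.sum, hqs.analyticAt, ?_⟩
  filter_upwards [Metric.eball_mem_nhds 0 hp.r_pos, Metric.eball_mem_nhds 0 hrad] with z hz hz'
  have hz0 : ((z.1, 0) : ℂ × ℂ) ∈ Metric.eball (0 : ℂ × ℂ) r := by
    rw [Metric.mem_eball, edist_zero_right] at hz ⊢
    refine lt_of_le_of_lt ?_ hz
    simp only [enorm_le_iff_norm_le, Prod.norm_def]
    simp
  have s1 := hp.hasSum hz
  have s2 := hp.hasSum hz0
  have s3 := (hqs.hasSum hz').mul_left z.2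
  rw [zero_add] at s1 s2 s3
  have s4 := s1.sub s2
  -- The terms of degree 0 cancel in the difference; dropping them shifts the index so that degree n
  -- + 1 of K matches degree n of the quotient.
  rw [← hasSum_nat_add_iff' 1] at s4
  have e : (fun n => z.2 * (q n) fun _ => z) =
      fun n => (p (n + 1) fun _ => z) - p (n + 1) fun _ => (z.1, 0) :=
    funext fun n => divTerm_apply _ _
  rw [e] at s3
  have := s4.unique s3
  simpa [Matrix.empty_eq] using this

/-- An analytic function of two variables that vanishes where the second variable does is divisible
by the second variable. -/
theorem exists_eq_snd_mul {K : ℂ × ℂ → ℂ} {a : ℂ} (hK : AnalyticAt ℂ K (a, 0))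
    (h0 : ∀ᶠ t in 𝓝 a, K (t, 0) = 0) :
    ∃ L : ℂ × ℂ → ℂ, AnalyticAt ℂ L (a, 0) ∧ ∀ᶠ z in 𝓝 (a, (0 : ℂ)), K z = z.2 * L z := by
  have hK' : AnalyticAt ℂ (fun z => K (z + (a, 0))) 0 := by
    refine AnalyticAt.fun_comp (g := K) (by simpa using hK) (by fun_prop)
  obtain ⟨L, hL, h⟩ := exists_eq_snd_mul_zero hK'
  have ht : Tendsto (fun z : ℂ × ℂ => z - (a, 0)) (𝓝 (a, 0)) (𝓝 0) := by
    have : Continuous (fun z : ℂ × ℂ => z - (a, 0)) := by fun_prop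
    simpa using this.tendsto (a, 0)
  refine ⟨fun z => L (z - (a, 0)), AnalyticAt.fun_comp (g := L) (by simpa using hL) (by fun_prop), ?_⟩
  have h0' : ∀ᶠ z in 𝓝 (a, (0 : ℂ)), K (z.1, 0) = 0 :=
    (continuous_fst.tendsto (a, (0 : ℂ))).eventually h0
  filter_upwards [ht.eventually h, h0'] with z hz hz0
  have : ((z - (a, 0)).1, (0 : ℂ)) + (a, 0) = (z.1, 0) := by ext <;> simp
  rw [this, hz0, sub_add_cancel] at hz
  simpa using hz

/-! ### Decomposition of power series according to residue classes -/

/-- A holomorphic germ in one variable decomposes along the powers `1, t, …, t^(N-1)` with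
coefficients that are holomorphic in `t^N`. -/
theorem exists_eq_sum_pow_mul {H : ℂ → ℂ} (hH : AnalyticAt ℂ H 0) (N : ℕ) [NeZero N] :
    ∃ K : ZMod N → ℂ → ℂ, (∀ i, AnalyticAt ℂ (K i) 0) ∧
      ∀ᶠ t in 𝓝 (0 : ℂ), H t = ∑ i : ZMod N, t ^ i.val * K i (t ^ N) := by
  obtain ⟨p, r, hp⟩ := hH
  set q : ZMod N → FormalMultilinearSeries ℂ ℂ ℂ := fun i =>
    FormalMultilinearSeries.ofScalars ℂ (fun n => p.coeff (i.val + N * n)) with hq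
  have hrad : ∀ i, 0 < (q i).radius := by
    intro i
    obtain ⟨ρ, hρ0, hρ⟩ := ENNReal.lt_iff_exists_nnreal_btwn.1 hp.radius_pos
    have hρ0' : 0 < ρ := by exact_mod_cast hρ0
    have hρr : (0 : ℝ) < ρ := hρ0'
    obtain ⟨C, hC, hb⟩ := p.norm_mul_pow_le_of_lt_radius hρ
    -- The series in t ^ N is tested at ρ ^ N, where its n-th term is a term of the original series
    -- at ρ up to the constant factor ρ ^ i.
    refine lt_of_lt_of_le (ENNReal.coe_pos.2 (pow_pos hρ0' N))
      ((q i).le_radius_of_bound (C / ρ ^ i.val) (r := ρ ^ N) fun n => ?_)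
    have h1 := hb (i.val + N * n)
    rw [hq, FormalMultilinearSeries.ofScalars_norm, le_div_iff₀ (pow_pos hρr _)]
    rw [← FormalMultilinearSeries.norm_apply_eq_norm_coef, NNReal.coe_pow, ← pow_mul, mul_assoc,
      ← pow_add, add_comm (N * n)]
    exact h1
  have hqs := fun i => (q i).hasFPowerSeriesOnBall (hrad i)
  refine ⟨fun i => (q i).sum, fun i => (hqs i).analyticAt, ?_⟩
  have hpow : Tendsto (fun t : ℂ => t ^ N) (𝓝 0) (𝓝 0) := by
    have : Continuous (fun t : ℂ => t ^ N) := by fun_prop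
    simpa [NeZero.ne N] using this.tendsto 0
  have hall : ∀ᶠ t in 𝓝 (0 : ℂ), ∀ i, t ^ N ∈ Metric.eball (0 : ℂ) (q i).radius :=
    eventually_all.2 fun i => hpow.eventually (Metric.eball_mem_nhds 0 (hrad i))
  filter_upwards [Metric.eball_mem_nhds 0 hp.r_pos, hall] with t ht ht'
  have s1 := hp.hasSum ht
  rw [zero_add] at s1
  simp only [FormalMultilinearSeries.apply_eq_pow_smul_coeff, smul_eq_mul] at s1
  rw [← s1.tsum_eq, Nat.sumByResidueClasses s1.summable N]
  refine Finset.sum_congr rfl fun i _ => ?_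
  have s3 := ((hqs i).hasSum (ht' i)).mul_left (t ^ i.val)
  rw [zero_add] at s3
  rw [← s3.tsum_eq]
  refine tsum_congr fun m => ?_
  rw [FormalMultilinearSeries.apply_eq_pow_smul_coeff, hq,
    FormalMultilinearSeries.coeff_ofScalars, smul_eq_mul, pow_add, pow_mul, mul_assoc]

/-- A holomorphic function whose derivative vanishes to order `n` has a primitive that vanishes to
order `n`. -/
theorem exists_primitive_pow_mul {r : ℂ → ℂ} (hr : AnalyticAt ℂ r 0) (n : ℕ) :
    ∃ H : ℂ → ℂ, AnalyticAt ℂ H 0 ∧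
      ∀ᶠ t in 𝓝 (0 : ℂ), deriv (fun u => u ^ n * H u) t = t ^ n * r t := by
  have hF : AnalyticAt ℂ (fun t => t ^ n * r t) 0 := by fun_prop
  obtain ⟨ε, hε, hd⟩ := Metric.eventually_nhds_iff_ball.1
    (hF.eventually_analyticAt.mono fun t ht => ht.differentiableAt)
  -- The primitive is normalized by G 0 = 0; otherwise its order at 0 would not be controlled by
  -- that of its derivative.
  obtain ⟨G, hG⟩ := (DifferentiableOn.isExactOn_ball (c := (0 : ℂ)) (r := ε)
    (fun t ht => (hd t ht).differentiableWithinAt)).with_val_at 0 0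
  obtain ⟨hG0, hG⟩ := hG
  have hGa : AnalyticAt ℂ G 0 := by
    rw [Complex.analyticAt_iff_eventually_differentiableAt]
    filter_upwards [Metric.ball_mem_nhds 0 hε] with t ht
    exact (hG t ht).differentiableAt
  have hder : deriv G =ᶠ[𝓝 0] fun t => t ^ n * r t := by
    filter_upwards [Metric.ball_mem_nhds 0 hε] with t ht
    exact (hG t ht).deriv
  have ho : ((n : ℕ) : ℕ∞) ≤ analyticOrderAt (deriv G) 0 := by
    rw [natCast_le_analyticOrderAt hGa.deriv]
    exact ⟨r, hr, hder.mono fun t ht => by simpa using ht⟩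
  have h1 := hGa.analyticOrderAt_deriv_add_one
  have ho' : ((n : ℕ) : ℕ∞) ≤ analyticOrderAt G 0 := by
    have : (fun x => G x - G 0) = G := by funext x; rw [hG0, sub_zero]
    rw [this] at h1
    rw [← h1]
    exact ho.trans le_self_add
  obtain ⟨H, hH, hGH⟩ := (natCast_le_analyticOrderAt hGa).1 ho'
  refine ⟨H, hH, ?_⟩
  have : G =ᶠ[𝓝 0] fun u => u ^ n * H u := hGH.mono fun t ht => by simpa using ht
  filter_upwards [this.deriv, hder] with t h1 h2
  rw [← h1, h2]

/-! ### The parametrization of the curve -/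

/-- The parametrization `t ↦ (-t⁵/(1+t), -t⁴/(1+t))` of the curve. -/
def gamma (t : ℂ) : ℂ × ℂ := (-t ^ 5 / (1 + t), -t ^ 4 / (1 + t))

theorem gamma_zero : gamma 0 = 0 := by simp [gamma]

theorem f_gamma {t : ℂ} (ht : 1 + t ≠ 0) : f (gamma t) = 0 := by
  simp only [f, gamma]
  field_simp
  ring

theorem gamma_snd_ne_zero {t : ℂ} (h0 : t ≠ 0) (h1 : 1 + t ≠ 0) : (gamma t).2 ≠ 0 := by
  simp [gamma, h0, h1]

theorem gamma_fst_add_snd {t : ℂ} (h1 : 1 + t ≠ 0) : (gamma t).1 + (gamma t).2 = -t ^ 4 := by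
  simp only [gamma]
  field_simp
  ring

theorem gamma_fst_div_snd {t : ℂ} (h0 : t ≠ 0) (h1 : 1 + t ≠ 0) :
    (gamma t).1 / (gamma t).2 = t := by
  simp only [gamma]
  field_simp

theorem analyticAt_gamma {t : ℂ} (h1 : 1 + t ≠ 0) : AnalyticAt ℂ gamma t := by
  refine AnalyticAt.prod ?_ ?_
  · exact ((analyticAt_id.pow 5).neg).div (analyticAt_const.add analyticAt_id) h1
  · exact ((analyticAt_id.pow 4).neg).div (analyticAt_const.add analyticAt_id) h1

theorem eventually_one_add_ne_zero {t : ℂ} (h1 : 1 + t ≠ 0) : ∀ᶠ u in 𝓝 t, 1 + u ≠ 0 :=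
  (continuous_const.add continuous_id).continuousAt.eventually_ne h1

/-- Every point of the curve other than the origin is `gamma t` with `t = x / y`. -/
theorem gamma_div_eq {p : ℂ × ℂ} (hp : f p = 0) (h0 : p ≠ 0) :
    p.2 ≠ 0 ∧ p.1 / p.2 ≠ 0 ∧ 1 + p.1 / p.2 ≠ 0 ∧ gamma (p.1 / p.2) = p := by
  obtain ⟨x, y⟩ := p
  simp only [f] at hp
  have hy : y ≠ 0 := by
    rintro rfl
    have : x = 0 := by simpa using hp
    exact h0 (by rw [this]; rfl)
  have hx : x ≠ 0 := by
    rintro rfl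
    exact hy (by simpa using hp)
  have h1 : x + y ≠ 0 := by
    intro h
    have : x ^ 4 = 0 := by linear_combination hp - y ^ 4 * h
    exact hx (by simpa using this)
  have h2 : 1 + x / y ≠ 0 := by
    intro h
    field_simp at h
    exact h1 (by linear_combination h)
  have h3 : y + x ≠ 0 := by rwa [add_comm]
  refine ⟨hy, div_ne_zero hx hy, h2, ?_⟩
  simp only [gamma, Prod.mk.injEq]
  constructor
  · field_simp
    linear_combination (-1 : ℂ) * hp
  · field_simp
    linear_combination (-1 : ℂ) * hp

theorem hasDerivAt_gamma_fst {t : ℂ} (h1 : 1 + t ≠ 0) :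
    HasDerivAt (fun u => (gamma u).1) (-(t ^ 4 * (5 + 4 * t)) / (1 + t) ^ 2) t := by
  have h := ((hasDerivAt_pow 5 t).neg).div ((hasDerivAt_id t).const_add 1) h1
  refine h.congr_deriv ?_
  simp only [Nat.cast_ofNat, Pi.neg_apply, id]
  congr 1
  ring

/-! ### A potential of the one-form along the curve -/

/-- A holomorphic function of `t` that vanishes to order `12` extends, along the parametrization, to
a holomorphic function on a neighbourhood of the origin of `ℂ²`. -/
theorem exists_comp_gamma_eq {H : ℂ → ℂ} (hH : AnalyticAt ℂ H 0) :
    ∃ g : ℂ × ℂ → ℂ, AnalyticAt ℂ g 0 ∧ ∀ᶠ t in 𝓝 (0 : ℂ), g (gamma t) = t ^ 12 * H t := by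
  obtain ⟨K, hK, h⟩ := exists_eq_sum_pow_mul hH 4
  have hw : AnalyticAt ℂ (fun z : ℂ × ℂ => -(z.1 + z.2)) 0 :=
    (analyticAt_fst.add analyticAt_snd).neg
  have hKw : ∀ i, AnalyticAt ℂ (fun z : ℂ × ℂ => K i (-(z.1 + z.2))) 0 := fun i =>
    AnalyticAt.fun_comp (g := K i) (by simpa using hK i) hw
  -- On the curve t⁴ = -(x+y), so the K i are evaluated at -(x+y) and only t¹², …, t¹⁵ remain to be
  -- lifted. The first is -(x+y)³. For the others, expand tᵏ = tᵏ(1+t)³/(1+t)³ and use that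
  -- t¹²/(1+t)³, …, t¹⁵/(1+t)³ are -y³, -xy², -x²y, -x³; higher powers are reduced by t⁴ = -(x+y).
  refine ⟨fun z => -(z.1 + z.2) ^ 3 * K 0 (-(z.1 + z.2))
    - (z.1 * z.2 ^ 2 + 3 * z.1 ^ 2 * z.2 + 3 * z.1 ^ 3 - z.2 ^ 3 * (z.1 + z.2))
        * K 1 (-(z.1 + z.2))
    - (z.2 * z.1 ^ 2 + 3 * z.1 ^ 3 - 3 * z.2 ^ 3 * (z.1 + z.2) - z.1 * z.2 ^ 2 * (z.1 + z.2))
        * K 2 (-(z.1 + z.2))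
    - (z.1 ^ 3 - 3 * z.2 ^ 3 * (z.1 + z.2) - 3 * z.1 * z.2 ^ 2 * (z.1 + z.2)
        - z.1 ^ 2 * z.2 * (z.1 + z.2)) * K 3 (-(z.1 + z.2)), ?_, ?_⟩
  · have hx : AnalyticAt ℂ (fun z : ℂ × ℂ => z.1) 0 := analyticAt_fst
    have hy : AnalyticAt ℂ (fun z : ℂ × ℂ => z.2) 0 := analyticAt_snd
    refine (((AnalyticAt.fun_mul ?_ (hKw 0)).fun_sub (AnalyticAt.fun_mul ?_ (hKw 1))).fun_sub
      (AnalyticAt.fun_mul ?_ (hKw 2))).fun_sub (AnalyticAt.fun_mul ?_ (hKw 3)) <;> fun_prop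
  · filter_upwards [h, eventually_one_add_ne_zero (t := 0) (by simp)] with t ht h1
    rw [ht, gamma_fst_add_snd h1, neg_neg]
    have e : ∀ F : ZMod 4 → ℂ, ∑ i, F i = F 0 + F 1 + F 2 + F 3 := Fin.sum_univ_four
    rw [e]
    have v0 : (0 : ZMod 4).val = 0 := rfl
    have v1 : (1 : ZMod 4).val = 1 := rfl
    have v2 : (2 : ZMod 4).val = 2 := rfl
    have v3 : (3 : ZMod 4).val = 3 := rfl
    rw [v0, v1, v2, v3]
    simp only [gamma]
    field_simp
    ring

/-- There is a holomorphic function whose restriction to the curve has derivative `α` along the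
parametrization. -/
theorem exists_potential : ∃ g : ℂ × ℂ → ℂ, AnalyticAt ℂ g 0 ∧ ∀ᶠ t in 𝓝 (0 : ℂ),
    deriv (fun u => g (gamma u)) t = coeff (gamma t) * deriv (fun u => (gamma u).1) t := by
  -- This is γ*α/dt divided by t¹²: the pullback is t²⁸(5/6 + 4t/5)(5 + 4t)/(1+t)⁸ dt, and only the
  -- conductor exponent 12 is split off.
  have hr : AnalyticAt ℂ
      (fun t : ℂ => t ^ 16 * (5 / 6 + 4 / 5 * t) * (5 + 4 * t) / (1 + t) ^ 8) 0 := by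
    refine AnalyticAt.div (by fun_prop) (by fun_prop) (by simp)
  obtain ⟨H, hH, hd⟩ := exists_primitive_pow_mul hr 12
  obtain ⟨g, hg, h⟩ := exists_comp_gamma_eq hH
  refine ⟨g, hg, ?_⟩
  have h' : (fun u => g (gamma u)) =ᶠ[𝓝 0] fun u => u ^ 12 * H u := h
  filter_upwards [h'.deriv, hd, eventually_one_add_ne_zero (t := 0) (by simp)] with t h1 h2 h3
  rw [h1, h2, (hasDerivAt_gamma_fst h3).deriv]
  simp only [coeff, gamma]
  field_simp
  ring

/-! ### Functions vanishing along the smooth part of the curve -/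

/-- Where y ≠ 0 and x + y ≠ 0, the functions t = x/y and w = f/y⁴ = t⁴ + (1+t)y are coordinates,
with inverse y = (w - t⁴)/(1+t), x = ty. The curve is w = 0 there, so the claim becomes divisibility
by a coordinate. -/
theorem exists_eq_f_mul {S : ℂ × ℂ → ℂ} {t : ℂ} (h0 : t ≠ 0) (h1 : 1 + t ≠ 0)
    (hS : AnalyticAt ℂ S (gamma t)) (hz : ∀ᶠ u in 𝓝 t, S (gamma u) = 0) :
    ∃ M : ℂ × ℂ → ℂ, AnalyticAt ℂ M (gamma t) ∧ ∀ᶠ z in 𝓝 (gamma t), S z = f z * M z := by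
  set Y : ℂ × ℂ → ℂ := fun c => (c.2 - c.1 ^ 4) / (1 + c.1) with hY
  have hYa : AnalyticAt ℂ Y (t, 0) :=
    (analyticAt_snd.sub (analyticAt_fst.pow 4)).div (analyticAt_const.add analyticAt_fst) h1
  have hline : ∀ u : ℂ, (u * Y (u, 0), Y (u, 0)) = gamma u := by
    intro u
    simp only [hY, gamma, Prod.mk.injEq]
    constructor <;> ring
  have hK : AnalyticAt ℂ (fun c : ℂ × ℂ => S (c.1 * Y c, Y c)) (t, 0) := by
    refine AnalyticAt.fun_comp (g := S) ?_ ((analyticAt_fst.mul hYa).prod hYa)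
    simpa only [Pi.mul_apply, hline t] using hS
  obtain ⟨L, hL, h⟩ := exists_eq_snd_mul hK (by
    filter_upwards [hz] with u hu
    simpa only [hline u] using hu)
  have hy := gamma_snd_ne_zero h0 h1
  have hΦ : AnalyticAt ℂ (fun z : ℂ × ℂ => (z.1 / z.2, f z / z.2 ^ 4)) (gamma t) :=
    (analyticAt_fst.div analyticAt_snd hy).prod
      ((analyticAt_f _).div (analyticAt_snd.pow 4) (pow_ne_zero 4 hy))
  have hΦ0 : ((gamma t).1 / (gamma t).2, f (gamma t) / (gamma t).2 ^ 4) = (t, 0) := by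
    rw [gamma_fst_div_snd h0 h1, f_gamma h1, zero_div]
  refine ⟨fun z => L (z.1 / z.2, f z / z.2 ^ 4) / z.2 ^ 4, ?_, ?_⟩
  · exact (AnalyticAt.fun_comp (g := L) (by rw [hΦ0]; exact hL) hΦ).div
      (analyticAt_snd.pow 4) (pow_ne_zero 4 hy)
  · have hc := hΦ.continuousAt.tendsto
    rw [hΦ0] at hc
    have e2 : ∀ᶠ z : ℂ × ℂ in 𝓝 (gamma t), z.2 ≠ 0 := continuous_snd.continuousAt.eventually_ne hy
    have e3 : ∀ᶠ z : ℂ × ℂ in 𝓝 (gamma t), z.1 + z.2 ≠ 0 := by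
      refine (continuous_fst.add continuous_snd).continuousAt.eventually_ne ?_
      rw [Pi.add_apply, gamma_fst_add_snd h1]
      exact neg_ne_zero.2 (pow_ne_zero 4 h0)
    filter_upwards [hc.eventually h, e2, e3] with z hz h2 h3
    have hYz : Y (z.1 / z.2, f z / z.2 ^ 4) = z.2 := by
      have h4 : z.2 + z.1 ≠ 0 := by rwa [add_comm]
      simp only [hY, f]
      field_simp
      ring
    rw [hYz, div_mul_cancel₀ _ h2] at hz
    rw [hz]
    ring

theorem HolGerm.mk_mem_J {S : ℂ × ℂ → ℂ} {t : ℂ} (h0 : t ≠ 0) (h1 : 1 + t ≠ 0)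
    (hS : AnalyticAt ℂ S (gamma t)) (hz : ∀ᶠ u in 𝓝 t, S (gamma u) = 0) :
    HolGerm.mk S hS ∈ J (gamma t) := by
  obtain ⟨M, hM, h⟩ := exists_eq_f_mul h0 h1 hS hz
  exact Ideal.mem_span_singleton.2 ⟨HolGerm.mk M hM, Subtype.ext (Germ.coe_eq.2 h)⟩

/-- At a smooth point of the curve, an element of the local ring is determined by its values along
the parametrization. -/
theorem OStalk.mk_eq_mk {S T : ℂ × ℂ → ℂ} {t : ℂ} (h0 : t ≠ 0) (h1 : 1 + t ≠ 0)
    (hS : AnalyticAt ℂ S (gamma t)) (hT : AnalyticAt ℂ T (gamma t))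
    (h : ∀ᶠ u in 𝓝 t, S (gamma u) = T (gamma u)) :
    OStalk.mk S hS = OStalk.mk T hT := by
  have h2 := HolGerm.mk_mem_J h0 h1 (hS.sub hT) (h.mono fun u hu => by simp [hu])
  have h3 : toO (gamma t) (HolGerm.mk S hS - HolGerm.mk T hT) = 0 := (toO_eq_zero_iff _).2 h2
  rw [map_sub] at h3
  exact sub_eq_zero.1 h3

theorem analyticAt_div_gamma {t : ℂ} (h0 : t ≠ 0) (h1 : 1 + t ≠ 0) :
    AnalyticAt ℂ (fun z : ℂ × ℂ => z.1 / z.2) (gamma t) :=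
  analyticAt_fst.div analyticAt_snd (gamma_snd_ne_zero h0 h1)

theorem analyticAt_comp_div {φ : ℂ → ℂ} {t : ℂ} (h0 : t ≠ 0) (h1 : 1 + t ≠ 0)
    (hφ : AnalyticAt ℂ φ t) : AnalyticAt ℂ (fun z : ℂ × ℂ => φ (z.1 / z.2)) (gamma t) :=
  AnalyticAt.fun_comp (g := φ) (by rwa [gamma_fst_div_snd h0 h1]) (analyticAt_div_gamma h0 h1)

theorem d0_comp_div {φ : ℂ → ℂ} {t : ℂ} (h0 : t ≠ 0) (h1 : 1 + t ≠ 0) (hφ : AnalyticAt ℂ φ t) :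
    d0 (gamma t) (OStalk.mk _ (analyticAt_comp_div h0 h1 hφ)) =
      OStalk.mk _ (analyticAt_comp_div h0 h1 hφ.deriv) •
        d0 (gamma t) (OStalk.mk _ (analyticAt_div_gamma h0 h1)) := by
  have hc := (analyticAt_div_gamma h0 h1).continuousAt.tendsto
  rw [gamma_fst_div_snd h0 h1] at hc
  have key : ∀ v : ℂ × ℂ, HolGerm.deriv v (HolGerm.mk _ (analyticAt_comp_div h0 h1 hφ)) =
      HolGerm.mk _ (analyticAt_comp_div h0 h1 hφ.deriv) *
        HolGerm.deriv v (HolGerm.mk _ (analyticAt_div_gamma h0 h1)) := by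
    intro v
    refine Subtype.ext (Germ.coe_eq.2 ?_)
    filter_upwards [hc.eventually hφ.eventually_analyticAt,
      (analyticAt_div_gamma h0 h1).eventually_analyticAt] with z hz hz'
    have := (hz.differentiableAt.hasDerivAt.comp_hasFDerivAt z hz'.differentiableAt.hasFDerivAt)
    change fderiv ℂ (φ ∘ fun z : ℂ × ℂ => z.1 / z.2) z v = _ * fderiv ℂ _ z v
    rw [this.fderiv]
    rfl
  rw [OStalk.mk, d0_mk, key, key, map_mul, map_mul, OStalk.mk, OStalk.mk, d0_mk]
  simp only [Omega1Stalk.mk, ← map_smul, Prod.smul_mk, smul_eq_mul]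

/-- Modulo f, a germ S at a smooth point equals (S∘γ)(x/y); the chain rule then expresses every
differential through d(x/y). This reduces identities between differentials to identities between
derivatives in t. -/
theorem d0_eq_smul {S : ℂ × ℂ → ℂ} {t : ℂ} (h0 : t ≠ 0) (h1 : 1 + t ≠ 0)
    (hS : AnalyticAt ℂ S (gamma t)) (hSg : AnalyticAt ℂ (fun u => S (gamma u)) t) :
    d0 (gamma t) (OStalk.mk S hS) = OStalk.mk _ (analyticAt_comp_div h0 h1 hSg.deriv) •
        d0 (gamma t) (OStalk.mk _ (analyticAt_div_gamma h0 h1)) := by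
  rw [← d0_comp_div h0 h1 hSg, OStalk.mk_eq_mk h0 h1 hS (analyticAt_comp_div h0 h1 hSg)]
  filter_upwards [eventually_one_add_ne_zero h1, eventually_ne_nhds h0] with u hu1 hu0
  rw [gamma_fst_div_snd hu0 hu1]

theorem d0_fst (p : ℂ × ℂ) :
    d0 p (OStalk.mk (fun z => z.1) analyticAt_fst) = Omega1Stalk.mk 1 0 := by
  have hx : HolGerm.deriv (1, 0) (HolGerm.mk (fun z : ℂ × ℂ => z.1) (analyticAt_fst (p := p))) =
      1 := by
    refine Subtype.ext (Germ.coe_eq.2 (Eventually.of_forall fun z => ?_))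
    change fderiv ℂ Prod.fst z (1, 0) = 1
    rw [fderiv_fst]; rfl
  have hy : HolGerm.deriv (0, 1) (HolGerm.mk (fun z : ℂ × ℂ => z.1) (analyticAt_fst (p := p))) =
      0 := by
    refine Subtype.ext (Germ.coe_eq.2 (Eventually.of_forall fun z => ?_))
    change fderiv ℂ Prod.fst z (0, 1) = 0
    rw [fderiv_fst]; rfl
  rw [OStalk.mk, d0_mk, hx, hy, map_one, map_zero]

/-- At a smooth point, `dS = c dx` holds as soon as it holds along the parametrization. -/
theorem d0_eq_mk {S c : ℂ × ℂ → ℂ} {t : ℂ} (h0 : t ≠ 0) (h1 : 1 + t ≠ 0)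
    (hS : AnalyticAt ℂ S (gamma t)) (hc : AnalyticAt ℂ c (gamma t))
    (h : ∀ᶠ u in 𝓝 t, deriv (fun u => S (gamma u)) u =
      c (gamma u) * deriv (fun u => (gamma u).1) u) :
    d0 (gamma t) (OStalk.mk S hS) = Omega1Stalk.mk (OStalk.mk c hc) 0 := by
  have hg := analyticAt_gamma h1
  have hSg : AnalyticAt ℂ (fun u => S (gamma u)) t := hS.fun_comp hg
  have hxg : AnalyticAt ℂ (fun u => (gamma u).1) t := analyticAt_fst.fun_comp hg
  have e : Omega1Stalk.mk (OStalk.mk c hc) 0 =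
      OStalk.mk c hc • d0 (gamma t) (OStalk.mk (fun z => z.1) analyticAt_fst) := by
    rw [d0_fst, Omega1Stalk.mk_eq, zero_smul, add_zero]
  rw [e, d0_eq_smul h0 h1 hS hSg, d0_eq_smul h0 h1 analyticAt_fst hxg, smul_smul]
  congr 1
  refine OStalk.mk_eq_mk h0 h1 _ (hc.mul (analyticAt_comp_div h0 h1 hxg.deriv)) ?_
  filter_upwards [h, eventually_one_add_ne_zero h1, eventually_ne_nhds h0] with u hu hu1 hu0
  rw [Pi.mul_apply, gamma_fst_div_snd hu0 hu1, hu]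

/-! ### Values and Taylor coefficients -/

/-- The value of a germ. -/
def HolGerm.eval (p : ℂ × ℂ) : HolGerm p →+* ℂ :=
  Germ.valueRingHom.comp (HolGerm p).toSubring.subtype

theorem HolGerm.eval_mk {p : ℂ × ℂ} (h : ℂ × ℂ → ℂ) (hh : AnalyticAt ℂ h p) :
    HolGerm.eval p (HolGerm.mk h hh) = h p := rfl

/-- The coordinate germ `x`. -/
def HolGerm.x : HolGerm 0 := HolGerm.mk (fun z => z.1) analyticAt_fst

/-- The coordinate germ `y`. -/
def HolGerm.y : HolGerm 0 := HolGerm.mk (fun z => z.2) analyticAt_snd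

theorem HolGerm.eval_x : HolGerm.eval 0 HolGerm.x = 0 := rfl

theorem HolGerm.eval_y : HolGerm.eval 0 HolGerm.y = 0 := rfl

theorem HolGerm.deriv_x (v : ℂ × ℂ) : HolGerm.deriv v HolGerm.x = algebraMap ℂ _ v.1 := by
  rw [Algebra.algebraMap_eq_smul_one]
  refine Subtype.ext (Germ.coe_eq.2 (Eventually.of_forall fun z => ?_))
  change fderiv ℂ Prod.fst z v = v.1 * 1
  rw [fderiv_fst, mul_one]; rfl

theorem HolGerm.deriv_y (v : ℂ × ℂ) : HolGerm.deriv v HolGerm.y = algebraMap ℂ _ v.2 := by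
  rw [Algebra.algebraMap_eq_smul_one]
  refine Subtype.ext (Germ.coe_eq.2 (Eventually.of_forall fun z => ?_))
  change fderiv ℂ Prod.snd z v = v.2 * 1
  rw [fderiv_snd, mul_one]; rfl

theorem HolGerm.mk_f (h : AnalyticAt ℂ f 0) :
    HolGerm.mk f h = HolGerm.x ^ 4 + HolGerm.y ^ 4 * HolGerm.x + HolGerm.y ^ 5 := rfl

theorem HolGerm.mk_coeff (h : AnalyticAt ℂ coeff 0) :
    HolGerm.mk coeff h = HolGerm.x ^ 4 * HolGerm.y
      + (5⁻¹ : ℂ) • (HolGerm.y ^ 5 * HolGerm.x) + (6⁻¹ : ℂ) • HolGerm.y ^ 6 := by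
  refine Subtype.ext (Germ.coe_eq.2 (Eventually.of_forall fun z => ?_))
  change z.1 ^ 4 * z.2 + z.2 ^ 5 * z.1 / 5 + z.2 ^ 6 / 6 =
    z.1 ^ 4 * z.2 + 5⁻¹ * (z.2 ^ 5 * z.1) + 6⁻¹ * z.2 ^ 6
  ring

/-- The iterated derivative `∂_y^n ∂_x^m` at the origin. -/
def taylor (m n : ℕ) : HolGerm 0 →+ ℂ :=
  (HolGerm.eval 0).toAddMonoidHom.comp
    ((((HolGerm.deriv (0, 1)).toLinearMap ^ n * (HolGerm.deriv (1, 0)).toLinearMap ^ m :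
      HolGerm 0 →ₗ[ℂ] HolGerm 0)).toAddMonoidHom)

theorem Derivation.pow_mul_of_eq_zero {A : Type*} [CommRing A] [Algebra ℂ A] (D : Derivation ℂ A A)
    {x : A} (hx : D x = 0) (n : ℕ) (u : A) :
    (D.toLinearMap ^ n) (x * u) = x * (D.toLinearMap ^ n) u := by
  induction n with
  | zero => rfl
  | succ n ih =>
    rw [pow_succ', Module.End.mul_apply, Module.End.mul_apply, ih]
    simp [hx]

theorem Derivation.pow_succ_mul_of_eq_one {A : Type*} [CommRing A] [Algebra ℂ A]
    (D : Derivation ℂ A A) {x : A} (hx : D x = 1) (n : ℕ) (u : A) :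
    (D.toLinearMap ^ (n + 1)) (x * u) =
      x * (D.toLinearMap ^ (n + 1)) u + (n + 1 : ℕ) • (D.toLinearMap ^ n) u := by
  induction n with
  | zero => simp [hx]
  | succ n ih =>
    rw [pow_succ', Module.End.mul_apply, ih, map_add, map_nsmul, ← Module.End.mul_apply _ _ u,
      ← pow_succ' _ n, Derivation.coeFn_coe, D.leibniz, hx, smul_eq_mul, smul_eq_mul, mul_one,
      ← Derivation.coeFn_coe, ← Module.End.mul_apply _ _ u, ← pow_succ' _ (n + 1),
      succ_nsmul _ (n + 1)]
    abel

/-- `taylor` is not divided by factorials, hence the factor m + 1. This rule and its three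
companions reduce a coefficient of a monomial times u to a coefficient of u. -/
theorem taylor_succ_x_mul (m n : ℕ) (u : HolGerm 0) :
    taylor (m + 1) n (HolGerm.x * u) = (m + 1) * taylor m n u := by
  change HolGerm.eval 0 (((HolGerm.deriv (0, 1)).toLinearMap ^ n)
    (((HolGerm.deriv (1, 0)).toLinearMap ^ (m + 1)) (HolGerm.x * u))) = _
  rw [Derivation.pow_succ_mul_of_eq_one _ (by simp [HolGerm.deriv_x]), map_add, map_nsmul,
    Derivation.pow_mul_of_eq_zero _ (by simp [HolGerm.deriv_x]), map_add, map_mul, HolGerm.eval_x,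
    zero_mul, zero_add, map_nsmul, nsmul_eq_mul]
  push_cast
  rfl

theorem taylor_zero_x_mul (n : ℕ) (u : HolGerm 0) : taylor 0 n (HolGerm.x * u) = 0 := by
  change HolGerm.eval 0 (((HolGerm.deriv (0, 1)).toLinearMap ^ n) (HolGerm.x * u)) = _
  rw [Derivation.pow_mul_of_eq_zero _ (by simp [HolGerm.deriv_x]), map_mul, HolGerm.eval_x,
    zero_mul]

theorem taylor_succ_y_mul (m n : ℕ) (u : HolGerm 0) :
    taylor m (n + 1) (HolGerm.y * u) = (n + 1) * taylor m n u := by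
  change HolGerm.eval 0 (((HolGerm.deriv (0, 1)).toLinearMap ^ (n + 1))
    (((HolGerm.deriv (1, 0)).toLinearMap ^ m) (HolGerm.y * u))) = _
  rw [Derivation.pow_mul_of_eq_zero _ (by simp [HolGerm.deriv_y]),
    Derivation.pow_succ_mul_of_eq_one _ (by simp [HolGerm.deriv_y]), map_add, map_mul,
    HolGerm.eval_y, zero_mul, zero_add, map_nsmul, nsmul_eq_mul]
  push_cast
  rfl

theorem taylor_zero_y_mul (m : ℕ) (u : HolGerm 0) : taylor m 0 (HolGerm.y * u) = 0 := by
  change HolGerm.eval 0 (((HolGerm.deriv (1, 0)).toLinearMap ^ m) (HolGerm.y * u)) = _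
  rw [Derivation.pow_mul_of_eq_zero _ (by simp [HolGerm.deriv_y]), map_mul, HolGerm.eval_y,
    zero_mul]

/-- A vector field `b ∂/∂x + e ∂/∂y` that multiplies `f` by `c`, up to terms of higher order,
has no linear part on the diagonal, and `c` vanishes at the origin. -/
theorem taylor_eq_zero_of_logarithmic {b e c u₁ u₂ u₃ : HolGerm 0}
    (h : b * (4 * HolGerm.x ^ 3 + HolGerm.y ^ 4)
        + e * (4 * HolGerm.y ^ 3 * HolGerm.x + 5 * HolGerm.y ^ 4) =
      c * (HolGerm.x ^ 4 + HolGerm.y ^ 4 * HolGerm.x + HolGerm.y ^ 5) +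
        (HolGerm.x ^ 4 * HolGerm.y * u₁ + HolGerm.y ^ 5 * HolGerm.x * u₂ + HolGerm.y ^ 6 * u₃)) :
    taylor 1 0 b = 0 ∧ taylor 0 1 e = 0 ∧ taylor 0 0 c = 0 := by
  set X := HolGerm.x with hX
  set Y := HolGerm.y with hY
  -- Monomials are unfolded into nested single factors so that the `taylor` rules can remove one
  -- factor at a time.
  have h' : (4 • (X * (X * (X * b))) + Y * (Y * (Y * (Y * b)))) +
      (4 • (X * (Y * (Y * (Y * e)))) + 5 • (Y * (Y * (Y * (Y * e))))) =
      (X * (X * (X * (X * c))) + X * (Y * (Y * (Y * (Y * c)))) + Y * (Y * (Y * (Y * (Y * c))))) +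
      (X * (X * (X * (X * (Y * u₁)))) + X * (Y * (Y * (Y * (Y * (Y * u₂))))) +
        Y * (Y * (Y * (Y * (Y * (Y * u₃)))))) := by
    simp only [nsmul_eq_mul]
    push_cast
    linear_combination h
  have key : ∀ m n, _ := fun m n => congrArg (taylor m n) h'
  simp only [map_add, map_nsmul] at key
  simp only [nsmul_eq_mul] at key
  have tx := taylor_succ_x_mul
  have ty := taylor_succ_y_mul
  have tx0 := taylor_zero_x_mul
  have ty0 := taylor_zero_y_mul
  simp only [← hX, ← hY] at tx ty tx0 ty0
  -- Coefficients of x⁴, x³y, xy⁴, y⁵ and x²y³; the terms in u₁, u₂, u₃ contribute to none of them.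
  -- Up to constants they read 4b_x = c, b_y = 0, b_x + 4e_y + 5e_x = c, b_y + 5e_y = c, e_x = 0 at
  -- the origin.
  have k40 := key 4 0
  have k31 := key 3 1
  have k14 := key 1 4
  have k05 := key 0 5
  have k23 := key 2 3
  norm_num [tx, ty, tx0, ty0] at k40 k31 k14 k05 k23
  -- Eliminating yields (1/4 + 4/5)c(0) = c(0), so c(0) = 0. This is where the term xy⁴ of f enters.
  have hc : taylor 0 0 c = 0 := by
    linear_combination (1 / (12 / 10) : ℂ) * (k14 - k40 - (16 / 100 : ℂ) * k05) - 100 * k23 + 16 * k31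
  refine ⟨?_, ?_, hc⟩
  · linear_combination (1 / 24 : ℂ) * k40 + (1 / 4 : ℂ) * hc
  · linear_combination (1 / 600 : ℂ) * k05 + (1 / 5 : ℂ) * hc - (1 / 5 : ℂ) * k31

/-! ### The relations of the Kähler differentials -/

/-- Since d(kf) = k df + f dk and f is zero in the structure sheaf, df alone generates the
relations. -/
theorem exists_eq_of_mem_dJ {p : ℂ × ℂ} {ω : OStalk p × OStalk p} (hω : ω ∈ dJ p) :
    ∃ h : HolGerm p, ω = (toO p (h * HolGerm.deriv (1, 0) (HolGerm.mk f (analyticAt_f p))),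
      toO p (h * HolGerm.deriv (0, 1) (HolGerm.mk f (analyticAt_f p)))) := by
  have hF : toO p (HolGerm.mk f (analyticAt_f p)) = 0 :=
    (toO_eq_zero_iff _).2 (Ideal.mem_span_singleton_self _)
  induction hω using Submodule.span_induction with
  | mem x hx =>
    obtain ⟨g, hg, rfl⟩ := hx
    obtain ⟨k, rfl⟩ := Ideal.mem_span_singleton.1 hg
    refine ⟨k, ?_⟩
    change (_, _) = _
    simp [hF]
  | zero => exact ⟨0, by simp [← Prod.zero_eq_mk]⟩
  | add x y _ _ hx hy =>
    obtain ⟨h, rfl⟩ := hx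
    obtain ⟨k, rfl⟩ := hy
    exact ⟨h + k, by simp [add_mul]⟩
  | smul c x _ ih =>
    obtain ⟨h, rfl⟩ := ih
    obtain ⟨c, rfl⟩ := toO_surjective p c
    exact ⟨c * h, by simp [mul_assoc]⟩

/-- The reason for the choice of α: it makes dα a multiple of f, giving flatness, and it produces
the term S·f in the computation at the origin. -/
theorem HolGerm.deriv_coeff (p : ℂ × ℂ) :
    HolGerm.deriv (0, 1) (HolGerm.mk coeff (analyticAt_coeff p)) =
      HolGerm.mk f (analyticAt_f p) := by
  refine Subtype.ext (Germ.coe_eq.2 (Eventually.of_forall fun z => ?_))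
  change fderiv ℂ coeff z (0, 1) = f z
  have hx : HasFDerivAt (fun z : ℂ × ℂ => z.1) (ContinuousLinearMap.fst ℂ ℂ ℂ) z := hasFDerivAt_fst
  have hy : HasFDerivAt (fun z : ℂ × ℂ => z.2) (ContinuousLinearMap.snd ℂ ℂ ℂ) z := hasFDerivAt_snd
  have h := (((hx.pow 4).mul hy).add (((hy.pow 5).mul hx).mul_const (5⁻¹ : ℂ))).add
    ((hy.pow 6).mul_const (6⁻¹ : ℂ))
  have h' : HasFDerivAt coeff _ z := h
  rw [h'.fderiv]
  simp [f]
  ring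

/-- A germ of a parallel section at the origin has value zero. -/
theorem eval_eq_zero_of_parallel (S : HolGerm 0)
    (h : d0 0 (toO 0 S) + toO 0 S • Omega1Stalk.mk (OStalk.mk coeff (analyticAt_coeff 0)) 0 = 0) :
    HolGerm.eval 0 S = 0 := by
  set F := HolGerm.mk f (analyticAt_f 0) with hF
  set c := HolGerm.mk coeff (analyticAt_coeff 0) with hc
  rw [d0_mk] at h
  simp only [Omega1Stalk.mk, ← map_smul, ← map_add] at h
  obtain ⟨k, hk⟩ := exists_eq_of_mem_dJ ((toOmega1_eq_zero_iff _).1 h)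
  simp only [Prod.smul_mk, Prod.mk_add_mk, smul_eq_mul, mul_zero, add_zero, Prod.mk.injEq] at hk
  obtain ⟨hk1, hk2⟩ := hk
  have h1 : toO 0 (HolGerm.deriv (1, 0) S + S * c - k * HolGerm.deriv (1, 0) F) = 0 := by
    rw [map_sub, map_add, map_mul, sub_eq_zero]
    exact hk1
  have h2 : toO 0 (HolGerm.deriv (0, 1) S - k * HolGerm.deriv (0, 1) F) = 0 := by
    rw [map_sub, sub_eq_zero]
    exact hk2
  obtain ⟨β₁, h1⟩ := Ideal.mem_span_singleton.1 ((toO_eq_zero_iff _).1 h1)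
  obtain ⟨β₂, h2⟩ := Ideal.mem_span_singleton.1 ((toO_eq_zero_iff _).1 h2)
  -- With F = f, the lifted equations are S_x + S a = k F_x + β₁F and S_y = k F_y + β₂F.
  -- Differentiating the first in y and the second in x and subtracting cancels S_xy and k F_xy.
  have h3 := congrArg (HolGerm.deriv (0, 1)) h1
  have h4 := congrArg (HolGerm.deriv (1, 0)) h2
  simp only [map_add, map_sub, Derivation.leibniz, smul_eq_mul] at h3 h4
  rw [HolGerm.deriv_comm (0, 1) (1, 0) S, HolGerm.deriv_comm (0, 1) (1, 0) F, hc,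
    HolGerm.deriv_coeff, ← hF, ← hc] at h3
  have hDF : HolGerm.deriv (1, 0) F = 4 * HolGerm.x ^ 3 + HolGerm.y ^ 4 := by
    rw [hF, HolGerm.mk_f]
    simp [Derivation.leibniz_pow, HolGerm.deriv_x, HolGerm.deriv_y]
  have hEF : HolGerm.deriv (0, 1) F = 4 * HolGerm.y ^ 3 * HolGerm.x + 5 * HolGerm.y ^ 4 := by
    rw [hF, HolGerm.mk_f]
    simp [Derivation.leibniz_pow, HolGerm.deriv_x, HolGerm.deriv_y]
    ring
  have hc' := HolGerm.mk_coeff (analyticAt_coeff 0)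
  rw [← hc, Algebra.smul_def, Algebra.smul_def] at hc'
  have hF' := HolGerm.mk_f (analyticAt_f 0)
  rw [← hF] at hF'
  have main := taylor_eq_zero_of_logarithmic (b := HolGerm.deriv (0, 1) k - β₂)
    (e := β₁ - HolGerm.deriv (1, 0) k)
    (c := S - (HolGerm.deriv (0, 1) β₁ - HolGerm.deriv (1, 0) β₂))
    (u₁ := HolGerm.deriv (0, 1) S) (u₂ := algebraMap ℂ _ 5⁻¹ * HolGerm.deriv (0, 1) S)
    (u₃ := algebraMap ℂ _ 6⁻¹ * HolGerm.deriv (0, 1) S) (by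
      rw [← hDF, ← hEF, ← hF']
      linear_combination h4 - h3 + HolGerm.deriv (0, 1) S * hc')
  obtain ⟨m1, m2, m3⟩ := main
  change HolGerm.eval 0 (HolGerm.deriv (1, 0) (HolGerm.deriv (0, 1) k - β₂)) = 0 at m1
  change HolGerm.eval 0 (HolGerm.deriv (0, 1) (β₁ - HolGerm.deriv (1, 0) k)) = 0 at m2
  change HolGerm.eval 0 (S - (HolGerm.deriv (0, 1) β₁ - HolGerm.deriv (1, 0) β₂)) = 0 at m3
  simp only [map_sub] at m1 m2 m3
  rw [HolGerm.deriv_comm (0, 1) (1, 0) k] at m2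
  -- The three vanishing values are S - (β₁)_y + (β₂)_x, k_xy - (β₂)_x and (β₁)_y - k_xy at 0;
  -- everything but S(0) cancels in the sum.
  linear_combination m3 + m1 + m2

/-! ### The derivative of a section along the curve -/

/-- A relation `a dx + b dy = 0` in `Ω¹` holds on tangent vectors of the curve. -/
theorem eval_tangent_eq_zero {p : ℂ × ℂ} (hp : f p = 0) {a b : HolGerm p}
    (h : Omega1Stalk.mk (toO p a) (toO p b) = 0) {v : ℂ × ℂ} (hv : fderiv ℂ f p v = 0) :
    HolGerm.eval p a * v.1 + HolGerm.eval p b * v.2 = 0 := by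
  obtain ⟨k, hk⟩ := exists_eq_of_mem_dJ ((toOmega1_eq_zero_iff _).1 h)
  have hJ : ∀ u w : HolGerm p, toO p u = toO p w → HolGerm.eval p u = HolGerm.eval p w := by
    intro u w huw
    rw [← sub_eq_zero, ← map_sub, toO_eq_zero_iff] at huw
    obtain ⟨m, hm⟩ := Ideal.mem_span_singleton.1 huw
    rw [← sub_eq_zero, ← map_sub, hm, map_mul, HolGerm.eval_mk, hp, zero_mul]
  rw [Prod.mk.injEq] at hk
  rw [hJ _ _ hk.1, hJ _ _ hk.2, map_mul, map_mul, HolGerm.deriv_mk, HolGerm.deriv_mk,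
    HolGerm.eval_mk, HolGerm.eval_mk]
  have hv' : v = v.1 • ((1, 0) : ℂ × ℂ) + v.2 • ((0, 1) : ℂ × ℂ) := by ext <;> simp
  rw [hv', map_add, map_smul, map_smul, smul_eq_mul, smul_eq_mul] at hv
  linear_combination HolGerm.eval p k * hv

/-- The differential equation satisfied by a parallel section along the parametrization. -/
theorem deriv_comp_gamma_of_parallel {S : ℂ × ℂ → ℂ} {t : ℂ} (h1 : 1 + t ≠ 0)
    (hS : AnalyticAt ℂ S (gamma t))
    (h : d0 (gamma t) (OStalk.mk S hS) +
      OStalk.mk S hS • Omega1Stalk.mk (OStalk.mk coeff (analyticAt_coeff _)) 0 = 0) :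
    deriv (fun u => S (gamma u)) t =
      -(S (gamma t) * (coeff (gamma t) * deriv (fun u => (gamma u).1) t)) := by
  have hg : HasDerivAt gamma (deriv gamma t) t :=
    (analyticAt_gamma h1).differentiableAt.hasDerivAt
  have hfst : deriv (fun u => (gamma u).1) t = (deriv gamma t).1 :=
    ((ContinuousLinearMap.fst ℂ ℂ ℂ).hasFDerivAt.comp_hasDerivAt t hg).deriv
  have hSd : deriv (fun u => S (gamma u)) t = fderiv ℂ S (gamma t) (deriv gamma t) :=
    (hS.differentiableAt.hasFDerivAt.comp_hasDerivAt t hg).deriv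
  have hfd : fderiv ℂ f (gamma t) (deriv gamma t) = 0 := by
    rw [← ((analyticAt_f (gamma t)).differentiableAt.hasFDerivAt.comp_hasDerivAt t hg).deriv]
    have : f ∘ gamma =ᶠ[𝓝 t] fun _ => 0 :=
      (eventually_one_add_ne_zero h1).mono fun u hu => f_gamma hu
    rw [this.deriv_eq, deriv_const]
  rw [OStalk.mk, d0_mk, OStalk.mk] at h
  have h' : Omega1Stalk.mk
      (toO (gamma t) (HolGerm.deriv (1, 0) (HolGerm.mk S hS) +
        HolGerm.mk S hS * HolGerm.mk coeff (analyticAt_coeff _)))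
      (toO (gamma t) (HolGerm.deriv (0, 1) (HolGerm.mk S hS))) = 0 := by
    rw [← h]
    simp only [Omega1Stalk.mk, ← map_smul, ← map_add]
    simp
  have key := eval_tangent_eq_zero (f_gamma h1) h' hfd
  rw [map_add, map_mul, HolGerm.deriv_mk, HolGerm.deriv_mk, HolGerm.eval_mk, HolGerm.eval_mk,
    HolGerm.eval_mk, HolGerm.eval_mk] at key
  have hv' : deriv gamma t = (deriv gamma t).1 • ((1, 0) : ℂ × ℂ) +
      (deriv gamma t).2 • ((0, 1) : ℂ × ℂ) := by ext <;> simp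
  rw [hSd, hfst]
  nth_rewrite 1 [hv']
  rw [map_add, map_smul, map_smul, smul_eq_mul, smul_eq_mul]
  linear_combination key

/-! ### Flatness -/

theorem d1_d0 {p : ℂ × ℂ} (a : OStalk p) : d1 p (d0 p a) = 0 := by
  obtain ⟨g, rfl⟩ := toO_surjective p a
  exact preD1_ambientD g

theorem d1_smul_mk {p : ℂ × ℂ} (a b c : OStalk p) :
    d1 p (a • Omega1Stalk.mk b c) =
      wedge (d0 p a) (Omega1Stalk.mk b c) + a • d1 p (Omega1Stalk.mk b c) :=
  preD1_smul a (b, c)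

theorem d0_one (p : ℂ × ℂ) : d0 p 1 = 0 := by
  have h := d0_mul (p := p) 1 1
  rw [mul_one, one_smul] at h
  exact left_eq_add.1 h

/-- The one-form `α` is closed on the curve. -/
theorem d1_alpha (p : ℂ × ℂ) :
    d1 p (Omega1Stalk.mk (OStalk.mk coeff (analyticAt_coeff p)) 0) = 0 := by
  have hw : wedge (0 : Omega1Stalk p) (Omega1Stalk.mk 0 1) = 0 := by
    simpa using wedge_smul_left 0 (0 : Omega1Stalk p) (Omega1Stalk.mk 0 1)
  have hF : toO p (HolGerm.mk f (analyticAt_f p)) = 0 :=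
    (toO_eq_zero_iff _).2 (Ideal.mem_span_singleton_self _)
  rw [d1_mk, map_zero, hw, add_zero, OStalk.mk, d0_mk, HolGerm.deriv_coeff, hF,
    Omega1Stalk.mk_eq, zero_smul, add_zero, wedge_smul_left, wedge_self, smul_zero]

theorem dPlus_alpha_apply {U : Opens Curve} (s : OSec U) (p : U) :
    (((dPlus alpha).toFun U s).1 p : Omega1Stalk p.1.1) = d0 p.1.1 (s.1 p) +
      (s.1 p : OStalk p.1.1) • Omega1Stalk.mk (OStalk.mk coeff (analyticAt_coeff p.1.1)) 0 :=
  rfl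

/-- As ∇1 = α, the curvature of s is ds∧α + s dα - (ds + sα)∧α, which reduces to s dα. -/
theorem isFlat_dPlus_alpha : (dPlus alpha).IsFlat := by
  intro U s p
  have h1 : ((1 : OSec U).1 p : OStalk p.1.1) = 1 := rfl
  rw [Connection.curvature, dPlus_alpha_apply, dPlus_alpha_apply, h1, d0_one, zero_add, one_smul,
    map_add, d1_d0, d1_smul_mk, d1_alpha, wedge_add_left, wedge_smul_left, wedge_self]
  simp

/-! ### The multivalued parallel section and its domain -/

/-- A small neighbourhood of the origin in the curve, the image of the disc of radius `ε` under
the parametrization. -/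
def disc (ε : ℝ) : Opens Curve :=
  ⟨{q | ‖q.1.1 + q.1.2‖ < ε ^ 4}, isOpen_lt (by fun_prop) continuous_const⟩

/-- The complement of the origin in the curve. -/
def punctured : Opens Curve :=
  ⟨{q | q.1 ≠ 0}, isOpen_ne_fun continuous_subtype_val continuous_const⟩

theorem origin_mem_disc {ε : ℝ} (hε : 0 < ε) : origin ∈ disc ε := by
  change ‖((0 : ℂ) + 0)‖ < ε ^ 4
  simpa using pow_pos hε 4

/-- On the curve x + y = -t⁴ with t = x/y, so the inequality defining `disc` says exactly that ‖t‖ <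
ε. -/
theorem norm_div_lt_of_mem_disc {ε : ℝ} (hε : 0 < ε) {q : Curve} (hq : q ∈ disc ε)
    (h0 : q.1 ≠ 0) : ‖q.1.1 / q.1.2‖ < ε := by
  obtain ⟨-, -, h1, h⟩ := gamma_div_eq q.2 h0
  have hq' : ‖q.1.1 + q.1.2‖ < ε ^ 4 := hq
  rw [← h, gamma_fst_add_snd h1, norm_neg, norm_pow] at hq'
  exact lt_of_pow_lt_pow_left₀ 4 hε.le hq'

theorem gamma_mem_disc {ε : ℝ} {t : ℂ} (h1 : 1 + t ≠ 0) (ht : ‖t‖ < ε) :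
    (⟨gamma t, f_gamma h1⟩ : Curve) ∈ disc ε := by
  change ‖(gamma t).1 + (gamma t).2‖ < ε ^ 4
  rw [gamma_fst_add_snd h1, norm_neg, norm_pow]
  exact pow_lt_pow_left₀ ht (norm_nonneg _) (by norm_num)

theorem gamma_ne_zero {t : ℂ} (h0 : t ≠ 0) (h1 : 1 + t ≠ 0) : gamma t ≠ 0 := fun h =>
  gamma_snd_ne_zero h0 h1 (by rw [h]; rfl)

/-- `g` is a potential of `α` along the image of the disc of radius `ε`. -/
structure IsPotential (g : ℂ × ℂ → ℂ) (ε : ℝ) : Prop where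
  pos : 0 < ε
  one_add_ne_zero : ∀ t : ℂ, ‖t‖ < ε → 1 + t ≠ 0
  analyticAt : ∀ t : ℂ, ‖t‖ < ε → AnalyticAt ℂ g (gamma t)
  deriv_eq : ∀ t : ℂ, ‖t‖ < ε → deriv (fun u => g (gamma u)) t =
    coeff (gamma t) * deriv (fun u => (gamma u).1) t

theorem tendsto_gamma_zero : Tendsto gamma (𝓝 0) (𝓝 0) := by
  have h := (analyticAt_gamma (t := 0) (by simp)).continuousAt.tendsto
  rwa [gamma_zero] at h

theorem exists_isPotential : ∃ (g : ℂ × ℂ → ℂ) (ε : ℝ), IsPotential g ε := by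
  obtain ⟨g, hg, hd⟩ := exists_potential
  obtain ⟨ε, hε, h⟩ := Metric.eventually_nhds_iff_ball.1
    (((eventually_one_add_ne_zero (t := 0) (by simp)).and
      (tendsto_gamma_zero.eventually hg.eventually_analyticAt)).and hd)
  have hb : ∀ t : ℂ, ‖t‖ < ε → t ∈ Metric.ball (0 : ℂ) ε := fun t ht => by simpa using ht
  exact ⟨g, ε, hε, fun t ht => (h t (hb t ht)).1.1, fun t ht => (h t (hb t ht)).1.2,
    fun t ht => (h t (hb t ht)).2⟩

namespace IsPotential

variable {g : ℂ × ℂ → ℂ} {ε : ℝ}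

theorem analyticAt_zero (h : IsPotential g ε) : AnalyticAt ℂ g 0 := by
  rw [← gamma_zero]
  exact h.analyticAt 0 (by simpa using h.pos)

theorem analyticAt_exp (h : IsPotential g ε) {q : Curve} (hq : q ∈ disc ε) :
    AnalyticAt ℂ (fun z => Complex.exp (-g z)) q.1 := by
  suffices hg : AnalyticAt ℂ g q.1 from hg.neg.cexp
  by_cases h0 : q.1 = 0
  · rw [h0]
    exact h.analyticAt_zero
  · have := h.analyticAt _ (norm_div_lt_of_mem_disc h.pos hq h0)
    rwa [(gamma_div_eq q.2 h0).2.2.2] at this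

/-- The section `exp (-g)` of the structure sheaf. -/
def expSec (h : IsPotential g ε) : OSec (disc ε) :=
  ⟨fun q => OStalk.mk _ (h.analyticAt_exp q.2), fun q =>
    ⟨{z | AnalyticAt ℂ (fun z => Complex.exp (-g z)) z}, isOpen_analyticAt ℂ _,
      h.analyticAt_exp q.2, _, fun _ hz => hz, fun _ _ => rfl⟩⟩

/-- Along γ the derivative of exp(-g) is -exp(-g) times the coefficient of γ*α; at a smooth point
`d0_eq_mk` turns this into an identity in Ω¹. -/
theorem parallel_exp_gamma (h : IsPotential g ε) {t : ℂ} (h0 : t ≠ 0) (ht : ‖t‖ < ε)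
    (ha : AnalyticAt ℂ (fun z => Complex.exp (-g z)) (gamma t)) :
    d0 (gamma t) (OStalk.mk _ ha) + OStalk.mk _ ha •
      Omega1Stalk.mk (OStalk.mk coeff (analyticAt_coeff (gamma t))) 0 = 0 := by
  have h1 := h.one_add_ne_zero t ht
  have hb : ∀ᶠ u in 𝓝 t, ‖u‖ < ε := continuous_norm.continuousAt.eventually_lt_const ht
  rw [d0_eq_mk h0 h1 ha (ha.mul (analyticAt_coeff _)).neg ?_]
  · have e : OStalk.mk _ (ha.mul (analyticAt_coeff (gamma t))).neg =
        -(OStalk.mk _ ha * OStalk.mk coeff (analyticAt_coeff (gamma t))) := by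
      rw [OStalk.mk, OStalk.mk, OStalk.mk, ← map_mul, ← map_neg]
      rfl
    rw [e]
    simp only [Omega1Stalk.mk, ← map_smul, ← map_add]
    simp [← Prod.zero_eq_mk]
  · filter_upwards [hb] with u hu
    have hd : HasDerivAt (fun u => g (gamma u)) _ u :=
      ((h.analyticAt u hu).fun_comp
        (analyticAt_gamma (h.one_add_ne_zero u hu))).differentiableAt.hasDerivAt
    rw [hd.fun_neg.cexp.deriv, h.deriv_eq u hu]
    simp only [Pi.neg_apply, Pi.mul_apply]
    ring

theorem parallel_expSec (h : IsPotential g ε) (q : disc ε) (h0 : q.1.1 ≠ 0) :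
    ((dPlus alpha).toFun (disc ε) h.expSec).1 q = 0 := by
  rw [dPlus_alpha_apply]
  change d0 q.1.1 (OStalk.mk _ (h.analyticAt_exp q.2)) +
    OStalk.mk _ (h.analyticAt_exp q.2) • _ = 0
  have ht := norm_div_lt_of_mem_disc h.pos q.2 h0
  obtain ⟨-, h2, -, h4⟩ := gamma_div_eq q.1.2 h0
  have key := h.parallel_exp_gamma h2 ht
  rw [h4] at key
  exact key _

end IsPotential

/-! ### Failure of tameness -/

/-- The witness is exp(-g) with X the origin: were it parallel everywhere, its value at 0 would
vanish, which an exponential cannot do. -/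
theorem not_isTame_dPlus_alpha : ¬ (dPlus alpha).IsTame := by
  intro ht
  obtain ⟨g, ε, h⟩ := exists_isPotential
  have key := ht (disc ε) h.expSec {q | q.1.1 = 0} ?_ ?_ (fun q hq => h.parallel_expSec q hq)
  · have h0 : d0 0 (OStalk.mk _ (h.analyticAt_zero.neg.cexp)) +
        OStalk.mk _ (h.analyticAt_zero.neg.cexp) •
          Omega1Stalk.mk (OStalk.mk coeff (analyticAt_coeff 0)) 0 = 0 :=
      congrFun (congrArg Subtype.val key) ⟨origin, origin_mem_disc h.pos⟩
    exact Complex.exp_ne_zero _ (eval_eq_zero_of_parallel _ h0)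
  · intro p
    refine ⟨Set.univ, isOpen_univ, trivial, 2, ![Prod.fst, Prod.snd], ?_, fun q _ => ?_⟩
    · intro i
      fin_cases i
      · exact fun z _ => analyticAt_fst
      · exact fun z _ => analyticAt_snd
    · rw [Fin.forall_fin_two]
      exact Prod.ext_iff
  · have hcl : IsClosed {q : disc ε | q.1.1 = 0} :=
      isClosed_eq (continuous_subtype_val.comp continuous_subtype_val) continuous_const
    rw [hcl.isNowhereDense_iff, Set.eq_empty_iff_forall_notMem]
    intro q hq
    have hq0 : q ∈ {q : disc ε | q.1.1 = 0} := interior_subset hq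
    rw [Set.mem_ofPred_eq] at hq0
    rw [mem_interior_iff_mem_nhds, nhds_induced, nhds_induced, comap_comap, mem_comap, hq0] at hq
    obtain ⟨V, hV, hVq⟩ := hq
    -- The origin is not interior to X because the points γ(t) with t ≠ 0 accumulate at it.
    have hs : ∀ᶠ t : ℂ in 𝓝[≠] 0, gamma t ∈ V ∧ ‖t‖ < ε ∧ t ≠ 0 := by
      have h1 : ∀ᶠ t : ℂ in 𝓝 0, ‖t‖ < ε :=
        continuous_norm.continuousAt.eventually_lt_const (by simpa using h.pos)
      filter_upwards [(tendsto_gamma_zero.eventually hV).filter_mono nhdsWithin_le_nhds,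
        h1.filter_mono nhdsWithin_le_nhds, self_mem_nhdsWithin] with t a b c using ⟨a, b, c⟩
    obtain ⟨t, htV, htε, ht0⟩ := hs.exists
    have h1 := h.one_add_ne_zero t htε
    exact gamma_ne_zero ht0 h1
      (@hVq ⟨⟨gamma t, f_gamma h1⟩, gamma_mem_disc h1 htε⟩ htV)

/-! ### Failure of local triviality -/

theorem OStalk.mk_eq_zero {S : ℂ × ℂ → ℂ} {q : ℂ × ℂ} (hq : f q = 0) (h0 : q ≠ 0)
    (hS : AnalyticAt ℂ S q) (hz : ∀ᶠ u in 𝓝 (q.1 / q.2), S (gamma u) = 0) :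
    OStalk.mk S hS = 0 := by
  obtain ⟨-, h2, h3, h4⟩ := gamma_div_eq hq h0
  generalize q.1 / q.2 = t at hz h2 h3 h4
  subst h4
  exact (toO_eq_zero_iff _).2 (HolGerm.mk_mem_J h2 h3 hS hz)

theorem OStalk.apply_eq_zero_of_mk_eq_zero {S : ℂ × ℂ → ℂ} {q : ℂ × ℂ} (hq : f q = 0)
    (hS : AnalyticAt ℂ S q) (h : OStalk.mk S hS = 0) : S q = 0 := by
  obtain ⟨m, hm⟩ := Ideal.mem_span_singleton.1 ((toO_eq_zero_iff _).1 h)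
  rw [← HolGerm.eval_mk S hS, hm, map_mul, HolGerm.eval_mk, hq, zero_mul]

/-- A holomorphic function inducing a parallel section near the origin vanishes on the curve near
the origin. -/
theorem eventually_comp_gamma_eq_zero {S : ℂ × ℂ → ℂ} (hS : AnalyticAt ℂ S 0)
    (h : ∀ᶠ z in 𝓝 (0 : ℂ × ℂ), f z = 0 → ∃ hz : AnalyticAt ℂ S z, d0 z (OStalk.mk S hz) +
      OStalk.mk S hz • Omega1Stalk.mk (OStalk.mk coeff (analyticAt_coeff z)) 0 = 0) :
    ∀ᶠ t in 𝓝 (0 : ℂ), S (gamma t) = 0 := by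
  obtain ⟨g, hg, hd⟩ := exists_potential
  have hS0 : S 0 = 0 := by
    obtain ⟨hz, e⟩ := h.self_of_nhds (by simp [f])
    exact eval_eq_zero_of_parallel _ e
  have hev := ((((tendsto_gamma_zero.eventually h).and hd).and
    (eventually_one_add_ne_zero (t := 0) (by simp))).and
    (tendsto_gamma_zero.eventually hg.eventually_analyticAt)).and
    (tendsto_gamma_zero.eventually hS.eventually_analyticAt)
  obtain ⟨δ, hδ, hb⟩ := Metric.eventually_nhds_iff_ball.1 hev
  -- The parallel equation gives (S∘γ)' = -(S∘γ)(g∘γ)', so this product has derivative zero; it is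
  -- constant on the ball and vanishes at 0 because S(0) = 0.
  set F : ℂ → ℂ := fun t => S (gamma t) * Complex.exp (g (gamma t)) with hF
  have hFd : ∀ t ∈ Metric.ball (0 : ℂ) δ, HasDerivAt F 0 t := by
    intro t ht
    obtain ⟨⟨⟨⟨e1, e2⟩, e3⟩, e4⟩, e5⟩ := hb t ht
    obtain ⟨hz, e⟩ := e1 (f_gamma e3)
    have dS : HasDerivAt (fun u => S (gamma u)) _ t :=
      (e5.fun_comp (analyticAt_gamma e3)).differentiableAt.hasDerivAt
    have dg : HasDerivAt (fun u => g (gamma u)) _ t :=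
      (e4.fun_comp (analyticAt_gamma e3)).differentiableAt.hasDerivAt
    rw [deriv_comp_gamma_of_parallel e3 hz e] at dS
    rw [e2] at dg
    refine (dS.fun_mul dg.cexp).congr_deriv ?_
    ring
  filter_upwards [Metric.ball_mem_nhds 0 hδ] with t ht
  have hc := Metric.isOpen_ball.is_const_of_deriv_eq_zero
    (convex_ball (0 : ℂ) δ).isPreconnected
    (fun u hu => (hFd u hu).differentiableAt.differentiableWithinAt)
    (fun u hu => (hFd u hu).deriv) ht (Metric.mem_ball_self hδ)
  simp only [hF, gamma_zero, hS0, zero_mul] at hc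
  exact (mul_eq_zero.1 hc).resolve_right (Complex.exp_ne_zero _)

theorem exists_gamma_mem {ε : ℝ} (hε : 0 < ε) {U : Opens Curve} (hU : origin ∈ U) :
    ∃ q : Curve, q ∈ U ∧ q ∈ disc ε ∧ q ∈ punctured := by
  have hU' : (U : Set Curve) ∈ 𝓝 origin := U.isOpen.mem_nhds hU
  rw [nhds_induced, mem_comap] at hU'
  obtain ⟨V, hV, hVU⟩ := hU'
  have h1 : ∀ᶠ t : ℂ in 𝓝 0, ‖t‖ < ε :=
    continuous_norm.continuousAt.eventually_lt_const (by simpa using hε)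
  have hs : ∀ᶠ t : ℂ in 𝓝[≠] 0, (gamma t ∈ V ∧ ‖t‖ < ε ∧ 1 + t ≠ 0) ∧ t ≠ 0 :=
    (((tendsto_gamma_zero.eventually hV).and (h1.and
      (eventually_one_add_ne_zero (t := 0) (by simp)))).filter_mono nhdsWithin_le_nhds).and
      self_mem_nhdsWithin
  obtain ⟨t, ⟨htV, htε, h1⟩, ht0⟩ := hs.exists
  exact ⟨⟨gamma t, f_gamma h1⟩, hVU htV, gamma_mem_disc h1 htε, gamma_ne_zero ht0 h1⟩

/-- The section exp(-g) is parallel once the origin is removed, and its nonzero values prevent it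
from being the zero section. -/
theorem exists_ne_zero_mem_ker {U : Opens Curve} (hU : origin ∈ U) :
    ∃ W ≤ U, ∃ s : (dPlus alpha).ker W, s ≠ 0 := by
  obtain ⟨g, ε, h⟩ := exists_isPotential
  obtain ⟨q, hqU, hqd, hq0⟩ := exists_gamma_mem h.pos hU
  have hle : U ⊓ (disc ε ⊓ punctured) ≤ disc ε := inf_le_right.trans inf_le_left
  refine ⟨U ⊓ (disc ε ⊓ punctured), inf_le_left, ⟨OSec.res hle h.expSec, ?_⟩, fun hs => ?_⟩
  · change (dPlus alpha).toFun _ _ = 0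
    rw [(dPlus alpha).map_res]
    exact Subtype.ext (funext fun p => h.parallel_expSec ⟨p.1, hle p.2⟩ p.2.2.2)
  · have h0 : OStalk.mk _ (h.analyticAt_exp hqd) = 0 :=
      congrFun (congrArg (fun s => s.1.1) hs) ⟨q, hqU, hqd, hq0⟩
    exact Complex.exp_ne_zero _ (OStalk.apply_eq_zero_of_mk_eq_zero q.2 _ h0)

/-- A parallel section defined at the origin has a local lift that vanishes along γ near t = 0. The
set V omits the origin, since `OStalk.mk_eq_zero` needs a smooth point; V being nonempty is enough
for the contradiction. -/
theorem exists_kerRes_eq_zero {U : Opens Curve} (hU : origin ∈ U) (s : (dPlus alpha).ker U) :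
    ∃ (V : Opens Curve) (hVU : V ≤ U), (∃ q, q ∈ V) ∧ (dPlus alpha).kerRes hVU s = 0 := by
  obtain ⟨W, hW, h0W, S, hS, hs⟩ := s.1.2 ⟨origin, hU⟩
  have hpar : ∀ q : U, ((dPlus alpha).toFun U s.1).1 q = 0 := fun q =>
    congrFun (congrArg Subtype.val s.2) q
  have hU' : (U : Set Curve) ∈ 𝓝 origin := U.isOpen.mem_nhds hU
  rw [nhds_induced, mem_comap] at hU'
  obtain ⟨V, hV, hVU⟩ := hU'
  have hz := eventually_comp_gamma_eq_zero (hS 0 h0W) (by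
    filter_upwards [hV, hW.mem_nhds h0W] with z hzV hzW hfz
    refine ⟨hS z hzW, ?_⟩
    have e := hpar ⟨⟨z, hfz⟩, hVU hzV⟩
    rw [dPlus_alpha_apply, hs _ hzW] at e
    exact e)
  obtain ⟨δ, hδ, hb⟩ := Metric.eventually_nhds_iff_ball.1 hz
  have hW' : IsOpen {q : Curve | q.1 ∈ W} := hW.preimage continuous_subtype_val
  obtain ⟨q, hq, hqd, hq0⟩ := exists_gamma_mem hδ (U := U ⊓ ⟨_, hW'⟩) ⟨hU, h0W⟩
  refine ⟨(U ⊓ ⟨_, hW'⟩) ⊓ (disc δ ⊓ punctured), inf_le_left.trans inf_le_left,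
    ⟨q, hq, hqd, hq0⟩, ?_⟩
  refine Subtype.ext (Subtype.ext (funext fun p => ?_))
  change s.1.1 ⟨p.1, p.2.1.1⟩ = 0
  rw [hs ⟨p.1, p.2.1.1⟩ p.2.1.2]
  refine OStalk.mk_eq_zero p.1.2 p.2.2.2 _ ?_
  have hlt := norm_div_lt_of_mem_disc hδ p.2.2.1 p.2.2.2
  filter_upwards [continuous_norm.continuousAt.eventually_lt_const hlt] with u hu
  exact hb u (by simpa using hu)

theorem not_kerIsLocalSystemOn_dPlus_alpha {Y : Opens Curve} (hY : origin ∈ Y) :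
    ¬ (dPlus alpha).KerIsLocalSystemOn Y := by
  intro hloc
  obtain ⟨U, hU, -, n, φ, hφ⟩ := hloc origin hY
  obtain _ | n := n
  -- Rank 0 is impossible because nonzero parallel sections exist on smaller open sets.
  · obtain ⟨W, hWU, s, hs⟩ := exists_ne_zero_mem_ker hU
    refine hs ((φ W hWU).injective ?_)
    ext q i
    exact i.elim0
  -- In positive rank, the parallel section corresponding to the constant 1 would restrict to zero
  -- on a nonempty open set.
  · set s := (φ U le_rfl).symm (LocallyConstant.const U fun _ => 1) with hsdef
    obtain ⟨V, hVU, ⟨q, hq⟩, h0⟩ := exists_kerRes_eq_zero hU s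
    have e := hφ U V hVU le_rfl s ⟨q, hq⟩
    rw [h0, LinearEquiv.map_zero, hsdef, LinearEquiv.apply_symm_apply] at e
    exact zero_ne_one (congrFun e 0)

end ReiffenCurve

end

theorem mainTheorem11 :
    (ReiffenCurve.dPlus ReiffenCurve.alpha).IsFlat ∧
    (∀ Y : TopologicalSpace.Opens ReiffenCurve.Curve, ReiffenCurve.origin ∈ Y →
      ¬ (ReiffenCurve.dPlus ReiffenCurve.alpha).KerIsLocalSystemOn Y) ∧
    ¬ (ReiffenCurve.dPlus ReiffenCurve.alpha).IsTame := by
  exact ⟨ReiffenCurve.isFlat_dPlus_alpha,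
    fun _ hY => ReiffenCurve.not_kerIsLocalSystemOn_dPlus_alpha hY,
    ReiffenCurve.not_isTame_dPlus_alpha⟩
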